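/- Let $\Lambda=\mathbb Z[t^{\pm1}]$, and let $L=K_1\cup\dots\cup K_\mu$ be an oriented virtual link with a diagram $D$. Let $A(D)$ be the set of arcs of $D$ (the components are cut at the classical underpasses only), let $C(D)$ be the set of classical crossings, and let $K_{\kappa(a)}$ be the component containing the arc $a$. At a classical crossing $c$ of writhe $w(c)$ let $a(c)$ be the overpassing arc, and let $b_1(c)$, $b_2(c)$ be the underpassing arcs on its right and on its left, respectively. A medial quandle is a set with an operation $\triangleright$ such that $x\triangleright x=x$, every map $x\mapsto x\triangleright y$ is bijective, and $(w\triangleright x)\triangleright(y\triangleright z)=(w\triangleright y)\triangleright(x\triangleright z)$. Let $\mathrm{MQ}(L)$ be the medial quandle generated by elements $q_a$, $a\in A(D)$, with the relations $q_{b_2(c)}=q_{b_1(c)}\triangleright q_{a(c)}$, $c\in C(D)$. Let $M=M_A^{\mathrm{red}}(L)$ be the $\Lambda$-module generated by elements $\varsigma(a)$, $a\in A(D)$, with the relations $(1-t)\varsigma(a(c))+t\,\varsigma(b_1(c))-\varsigma(b_2(c))=0$, $c\in C(D)$. Let $\phi=\phi_L^{\mathrm{red}}:M\to\Lambda$ be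 the $\Lambda$-linear map with $\phi(\varsigma(a))=1$ for all $a\in A(D)$. Let $\phi_\tau:M\to\Lambda\oplus\mathbb Z^{\mu-1}$ (with $t$ acting trivially on $\mathbb Z^{\mu-1}$) be the $\Lambda$-linear map with $\phi_\tau(\varsigma(a))=(1,0)$ if $\kappa(a)=1$, and $\phi_\tau(\varsigma(a))=(1,e_{\kappa(a)})$ if $\kappa(a)\ge2$, where $e_2,\dots,e_\mu$ is the standard basis of $\mathbb Z^{\mu-1}$. A meridian of $K_i$ is an element $x\in M$ with $\phi_\tau(x)=\phi_\tau(\varsigma(a))$ for some arc $a$ of $K_i$. The longitude of $K_i$ is $$\chi_i(L)=\varsigma\Bigl(\sum_{\kappa(b_1(c))=i}w(c)\,a(c)-\tfrac12\sum_{\kappa(b_1(c))=i}w(c)\,(b_1(c)+b_2(c))\Bigr)\in\ker\phi ,$$ where the sums range over $c\in C(D)$, $\varsigma$ is extended $\Lambda$-linearly to $\Lambda^{A(D)}$, and the second sum has even coefficients. It satisfies $(1-t)\chi_i(L)=0$. Let $X_i$ be the submodule of $\ker\phi$ generated by $\chi_i(L)$. Choose a meridian $m_i$ of $K_i$ for each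 $i$. Let $Q(\ker\phi,(m_i),(X_i))$ be the quandle whose underlying set is the disjoint union of the sets $Q_i=\ker\phi/X_i$, with $$x\triangleright y=m_j-m_i+tx+(1-t)y+X_i\in Q_i\qquad(x\in Q_i,\ y\in Q_j).$$ Let $f:Q(\ker\phi,(m_i),(X_i))\to M$ be the natural map, $f(x)=m_i+(1-t)x$ for $x\in Q_i$. It is a quandle map into the Alexander quandle on $M$, in which $x\triangleright y=tx+(1-t)y$. Let $Q_A^{\mathrm{red}}(L)=\bigcup_i(m_i+(1-t)\ker\phi)$ be its image. **Theorem.** Suppose that all longitudes generate the same submodule of $\ker\phi$, i.e. $X_1=\dots=X_\mu$. Then $\mathrm{MQ}(L)\cong Q_A^{\mathrm{red}}(L)$ via the natural map. That is, there are quandle isomorphisms $g:\mathrm{MQ}(L)\to Q(\ker\phi,(m_i),(X_i))$ and $e:\mathrm{MQ}(L)\to Q_A^{\mathrm{red}}(L)$ such that $e(x)=f(g(x))$ for all $x\in\mathrm{MQ}(L)$; moreover $e(q_a)=\varsigma(a)$ for every arc $a\in A(D)$. -/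

import Mathlib

open scoped Quandles

/-! ## Laurent polynomials and modules over them -/

/-- The ring `Λ = ℤ[t, t⁻¹]`. -/
abbrev Lam : Type := LaurentPolynomial ℤ

namespace Lam

/-- The variable `t` of `Λ`. -/
noncomputable def t : Lam := LaurentPolynomial.T 1

/-- The inverse `t⁻¹` of the variable of `Λ`. -/
noncomputable def tInv : Lam := LaurentPolynomial.T (-1)

theorem t_mul_tInv : t * tInv = 1 := by
  rw [t, tInv, ← LaurentPolynomial.T_add]
  simp

theorem tInv_mul_t : tInv * t = 1 := by
  rw [mul_comm, t_mul_tInv]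

/-- The augmentation `Λ → ℤ`, `t ↦ 1`. -/
noncomputable def aug : Lam →+* ℤ := LaurentPolynomial.eval₂ (RingHom.id ℤ) 1

theorem aug_t : aug t = 1 := by
  rw [aug, t, LaurentPolynomial.eval₂_T]
  simp

end Lam

/-- The abelian group `ℤ`, regarded as a `Λ`-module on which `t` acts trivially. -/
def TrivInt : Type := ℤ

namespace TrivInt

instance : AddCommGroup TrivInt := inferInstanceAs (AddCommGroup ℤ)

noncomputable instance : Module Lam TrivInt :=
  letI : Module ℤ TrivInt := inferInstanceAs (Module ℤ ℤ)
  Module.compHom TrivInt Lam.aug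

/-- The generator of the trivial module `ℤ`. -/
def one : TrivInt := (1 : ℤ)

theorem t_smul (x : TrivInt) : Lam.t • x = x := by
  let _ : Module ℤ TrivInt := inferInstanceAs (Module ℤ ℤ)
  change Lam.aug Lam.t • x = x
  rw [Lam.aug_t, one_smul]

end TrivInt

/-! ## Quandles

The quandle operation `x ▷ y` (in which `y` acts on `x`) is Mathlib's `y ◃ x`, and `x ▷⁻¹ y` is
`y ◃⁻¹ x`.  With this dictionary the medial law
`(w ▷ x) ▷ (y ▷ z) = (w ▷ y) ▷ (x ▷ z)` is `Rack.IsAbelian`. -/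

/-- The image of a quandle homomorphism is a quandle, with the operations of the codomain. -/
instance ShelfHom.rangeQuandle {Q R : Type*} [Quandle Q] [Quandle R] (f : Q →◃ R) :
    Quandle (Set.range f) where
  act x y := ⟨x.1 ◃ y.1, by
    obtain ⟨_, a, rfl⟩ := x
    obtain ⟨_, b, rfl⟩ := y
    exact ⟨a ◃ b, f.map_act⟩⟩
  self_distrib := Subtype.ext Shelf.self_distrib
  invAct x y := ⟨x.1 ◃⁻¹ y.1, by
    obtain ⟨_, a, rfl⟩ := x
    obtain ⟨_, b, rfl⟩ := y
    refine ⟨a ◃⁻¹ b, ?_⟩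
    rw [← Rack.left_cancel (f a), ← f.map_act]
    simp⟩
  left_inv x y := Subtype.ext (Rack.left_inv x.1 y.1)
  right_inv x y := Subtype.ext (Rack.right_inv x.1 y.1)
  fix := Subtype.ext Quandle.fix

/-! ### Medial quandles given by generators and relations -/

/-- Formal quandle expressions in a set `G` of generators; `act y x` stands for `x ▷ y` and
`invAct y x` stands for `x ▷⁻¹ y`. -/
inductive QuandleTerm (G : Type*) : Type _
  | gen (g : G) : QuandleTerm G
  | act (y x : QuandleTerm G) : QuandleTerm G
  | invAct (y x : QuandleTerm G) : QuandleTerm G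

/-- The value of a formal expression in a quandle, given the values of the generators. -/
def QuandleTerm.eval {G Q : Type*} [Quandle Q] (v : G → Q) : QuandleTerm G → Q
  | .gen g => v g
  | .act y x => y.eval v ◃ x.eval v
  | .invAct y x => y.eval v ◃⁻¹ x.eval v

/-- The congruence on formal expressions generated by the relations `r` and the axioms of medial
quandles. -/
inductive MedialRel {G : Type*} (r : QuandleTerm G → QuandleTerm G → Prop) :
    QuandleTerm G → QuandleTerm G → Prop
  | refl (x : QuandleTerm G) : MedialRel r x x
  | symm {x y} : MedialRel r x y → MedialRel r y x
  | trans {x y z} : MedialRel r x y → MedialRel r y z → MedialRel r x z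
  | act_congr {x x' y y' : QuandleTerm G} : MedialRel r x x' → MedialRel r y y' →
      MedialRel r (x.act y) (x'.act y')
  | invAct_congr {x x' y y' : QuandleTerm G} : MedialRel r x x' → MedialRel r y y' →
      MedialRel r (x.invAct y) (x'.invAct y')
  | fix (x : QuandleTerm G) : MedialRel r (x.act x) x
  | left_inv (x y : QuandleTerm G) : MedialRel r (x.invAct (x.act y)) y
  | right_inv (x y : QuandleTerm G) : MedialRel r (x.act (x.invAct y)) y
  | medial (x y z w : QuandleTerm G) :
      MedialRel r ((x.act y).act (z.act w)) ((x.act z).act (y.act w))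
  | of {x y} : r x y → MedialRel r x y

/-- The equivalence relation `MedialRel r`. -/
def medialSetoid {G : Type*} (r : QuandleTerm G → QuandleTerm G → Prop) :
    Setoid (QuandleTerm G) where
  r := MedialRel r
  iseqv := ⟨MedialRel.refl, MedialRel.symm, MedialRel.trans⟩

/-- The medial quandle generated by `G` subject to the relations `r`. -/
def PresentedMedialQuandle {G : Type*} (r : QuandleTerm G → QuandleTerm G → Prop) : Type _ :=
  Quotient (medialSetoid r)

namespace PresentedMedialQuandle

variable {G : Type*} (r : QuandleTerm G → QuandleTerm G → Prop)

instance : Quandle (PresentedMedialQuandle r) where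
  act := Quotient.map₂ QuandleTerm.act fun _ _ h _ _ h' => MedialRel.act_congr h h'
  self_distrib := by
    rintro ⟨x⟩ ⟨y⟩ ⟨z⟩
    refine Quotient.sound ?_
    exact (MedialRel.act_congr (MedialRel.symm (MedialRel.fix x)) (MedialRel.refl _)).trans
      (MedialRel.medial x x y z)
  invAct := Quotient.map₂ QuandleTerm.invAct fun _ _ h _ _ h' => MedialRel.invAct_congr h h'
  left_inv := by
    rintro ⟨x⟩ ⟨y⟩
    exact Quotient.sound (MedialRel.left_inv x y)
  right_inv := by
    rintro ⟨x⟩ ⟨y⟩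
    exact Quotient.sound (MedialRel.right_inv x y)
  fix := by
    rintro ⟨x⟩
    exact Quotient.sound (MedialRel.fix x)

/-- The class of a formal expression. -/
def mk (x : QuandleTerm G) : PresentedMedialQuandle r := Quotient.mk (medialSetoid r) x

/-- The class of a generator. -/
def of (g : G) : PresentedMedialQuandle r := mk r (.gen g)

theorem isAbelian : Rack.IsAbelian (PresentedMedialQuandle r) := by
  rintro ⟨x⟩ ⟨y⟩ ⟨z⟩ ⟨w⟩
  exact Quotient.sound (MedialRel.medial x y z w)

theorem mk_eq_eval (x : QuandleTerm G) : mk r x = x.eval (of r) := by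
  induction x with
  | gen g => rfl
  | act y x hy hx => rw [QuandleTerm.eval, ← hy, ← hx]; rfl
  | invAct y x hy hx => rw [QuandleTerm.eval, ← hy, ← hx]; rfl

/-- The relations hold in the presented quandle. -/
theorem eval_of_eq {x y : QuandleTerm G} (h : r x y) : x.eval (of r) = y.eval (of r) := by
  rw [← mk_eq_eval, ← mk_eq_eval]
  exact Quotient.sound (MedialRel.of h)

variable {r} {Q : Type*} [Quandle Q]

theorem eval_eq (hQ : Rack.IsAbelian Q) (v : G → Q)
    (hv : ∀ x y, r x y → x.eval v = y.eval v) {x y : QuandleTerm G} (h : MedialRel r x y) :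
    x.eval v = y.eval v := by
  induction h with
  | refl => rfl
  | symm _ ih => exact ih.symm
  | trans _ _ ih ih' => exact ih.trans ih'
  | act_congr _ _ ih ih' => simp only [QuandleTerm.eval, ih, ih']
  | invAct_congr _ _ ih ih' => simp only [QuandleTerm.eval, ih, ih']
  | fix => simp [QuandleTerm.eval]
  | left_inv => simp [QuandleTerm.eval]
  | right_inv => simp [QuandleTerm.eval]
  | medial => exact hQ _ _ _ _
  | of h => exact hv _ _ h

/-- The universal property of the presented medial quandle: existence. -/
def lift (hQ : Rack.IsAbelian Q) (v : G → Q) (hv : ∀ x y, r x y → x.eval v = y.eval v) :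
    PresentedMedialQuandle r →◃ Q where
  toFun := Quotient.lift (QuandleTerm.eval v) fun _ _ h => eval_eq hQ v hv h
  map_act' := by
    rintro ⟨x⟩ ⟨y⟩
    rfl

theorem lift_of (hQ : Rack.IsAbelian Q) (v : G → Q)
    (hv : ∀ x y, r x y → x.eval v = y.eval v) (g : G) : lift hQ v hv (of r g) = v g := rfl

/-- The universal property of the presented medial quandle: uniqueness. -/
theorem hom_ext {f f' : PresentedMedialQuandle r →◃ Q} (h : ∀ g, f (of r g) = f' (of r g))
    (q : PresentedMedialQuandle r) : f q = f' q := by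
  obtain ⟨x, rfl⟩ : ∃ x, mk r x = q := Quotient.exists_rep q
  induction x with
  | gen g => exact h g
  | act y x hy hx =>
    have e : mk r (y.act x) = mk r y ◃ mk r x := rfl
    rw [e, f.map_act, f'.map_act, hy, hx]
  | invAct y x hy hx =>
    have e : mk r (y.invAct x) = mk r y ◃⁻¹ mk r x := rfl
    rw [e, ← Rack.left_cancel (f (mk r y)), ← f.map_act, hy, ← f'.map_act]
    simp [hx]

end PresentedMedialQuandle

/-! ### Alexander quandles -/

/-- The standard Alexander quandle on a `Λ`-module `M`, with `x ▷ y = t x + (1 - t) y` and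
`x ▷⁻¹ y = t⁻¹ x + (1 - t⁻¹) y`. -/
def AlexanderQuandle (M : Type*) : Type _ := M

noncomputable instance {M : Type*} [AddCommGroup M] [Module Lam M] :
    Quandle (AlexanderQuandle M) where
  act (y x : M) := (Lam.t • x + (1 - Lam.t) • y : M)
  self_distrib {x y z : M} := by
    change (_ : M) = _
    simp only [sub_smul, smul_add, smul_sub, one_smul]
    abel
  invAct (y x : M) := (Lam.tInv • x + (1 - Lam.tInv) • y : M)
  left_inv (x y : M) := by
    change (_ : M) = _
    simp only [sub_smul, smul_add, smul_sub, one_smul, smul_smul, Lam.tInv_mul_t]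
    abel
  right_inv (x y : M) := by
    change (_ : M) = _
    simp only [sub_smul, smul_add, smul_sub, one_smul, smul_smul, Lam.t_mul_tInv]
    abel
  fix {x : M} := by
    change (_ : M) = _
    simp only [sub_smul, one_smul]
    abel

/-! ### The medial quandle `Q(N, (mᵢ), (Xᵢ))` -/

/-- A submodule `N` of a `Λ`-module `M`, elements `mᵢ ∈ M` with `mᵢ - mⱼ ∈ N`, and submodules `Xᵢ`
of `N` with `(1 - t) Xᵢ = 0`. -/
structure MedialData (I M : Type*) [AddCommGroup M] [Module Lam M] where
  N : Submodule Lam M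
  m : I → M
  X : I → Submodule Lam N
  sub_mem : ∀ i j, m i - m j ∈ N
  smul_eq_zero : ∀ i, ∀ x ∈ X i, (1 - Lam.t) • x = 0

namespace MedialData

variable {I M : Type*} [AddCommGroup M] [Module Lam M] (S : MedialData I M)

/-- The disjoint union of the quotients `Qᵢ = N / Xᵢ`. -/
def Carrier : Type _ := Σ i : I, S.N ⧸ S.X i

/-- The element `x + Xᵢ` of `Qᵢ`. -/
noncomputable def cls (i : I) (x : S.N) : S.Carrier := ⟨i, (S.X i).mkQ x⟩

/-- The element `mⱼ - mᵢ` of `N`. -/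
def diff (i j : I) : S.N := ⟨S.m j - S.m i, S.sub_mem j i⟩

/-- Multiplication by `1 - t`, as a map `N / Xⱼ → N / Xᵢ`. -/
noncomputable def oneSubT (i j : I) : (S.N ⧸ S.X j) →ₗ[Lam] (S.N ⧸ S.X i) :=
  (S.X j).liftQ ((S.X i).mkQ ∘ₗ LinearMap.lsmul Lam S.N (1 - Lam.t)) fun x hx => by
    have h := S.smul_eq_zero j x hx
    rw [LinearMap.mem_ker, LinearMap.comp_apply, LinearMap.lsmul_apply, h, map_zero]

/-- `x ▷ y = mⱼ - mᵢ + t x + (1 - t) y + Xᵢ` for `x ∈ Qᵢ` and `y ∈ Qⱼ`. -/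
noncomputable def op (x y : S.Carrier) : S.Carrier :=
  ⟨x.1, (S.X x.1).mkQ (S.diff x.1 y.1) + Lam.t • x.2 + S.oneSubT x.1 y.1 y.2⟩

/-- `x ▷⁻¹ y = t⁻¹ (mᵢ - mⱼ + x - (1 - t) y) + Xᵢ` for `x ∈ Qᵢ` and `y ∈ Qⱼ`. -/
noncomputable def invOp (x y : S.Carrier) : S.Carrier :=
  ⟨x.1, Lam.tInv • ((S.X x.1).mkQ (S.diff y.1 x.1) + x.2 - S.oneSubT x.1 y.1 y.2)⟩

theorem exists_cls (x : S.Carrier) : ∃ i y, S.cls i y = x := by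
  obtain ⟨i, x⟩ := x
  obtain ⟨y, rfl⟩ := (S.X i).mkQ_surjective x
  exact ⟨i, y, rfl⟩

theorem op_cls (i j : I) (x y : S.N) : S.op (S.cls i x) (S.cls j y) =
    S.cls i (S.diff i j + Lam.t • x + (1 - Lam.t) • y) := rfl

theorem invOp_cls (i j : I) (x y : S.N) : S.invOp (S.cls i x) (S.cls j y) =
    S.cls i (Lam.tInv • (S.diff j i + x - (1 - Lam.t) • y)) := rfl

theorem op_medial (w x y z : S.Carrier) :
    S.op (S.op w x) (S.op y z) = S.op (S.op w y) (S.op x z) := by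
  obtain ⟨h, w, rfl⟩ := S.exists_cls w
  obtain ⟨i, x, rfl⟩ := S.exists_cls x
  obtain ⟨j, y, rfl⟩ := S.exists_cls y
  obtain ⟨k, z, rfl⟩ := S.exists_cls z
  simp only [op_cls]
  congr 1
  apply Subtype.ext
  simp only [diff, Submodule.coe_add, Submodule.coe_smul]
  module

theorem op_self (x : S.Carrier) : S.op x x = x := by
  obtain ⟨i, x, rfl⟩ := S.exists_cls x
  rw [op_cls]
  congr 1
  apply Subtype.ext
  simp only [diff, Submodule.coe_add, Submodule.coe_smul]
  module

noncomputable instance : Quandle S.Carrier where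
  act y x := S.op x y
  self_distrib {x y z} := by
    have h := S.op_medial z y x x
    rwa [op_self] at h
  invAct y x := S.invOp x y
  left_inv y x := by
    obtain ⟨i, x, rfl⟩ := S.exists_cls x
    obtain ⟨j, y, rfl⟩ := S.exists_cls y
    change S.invOp (S.op (S.cls i x) (S.cls j y)) (S.cls j y) = S.cls i x
    rw [op_cls, invOp_cls]
    congr 1
    apply Subtype.ext
    simp only [diff, Submodule.coe_add, Submodule.coe_smul, AddSubgroupClass.coe_sub]
    match_scalars <;> first | ring1 | linear_combination Lam.tInv_mul_t
  right_inv y x := by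
    obtain ⟨i, x, rfl⟩ := S.exists_cls x
    obtain ⟨j, y, rfl⟩ := S.exists_cls y
    change S.op (S.invOp (S.cls i x) (S.cls j y)) (S.cls j y) = S.cls i x
    rw [invOp_cls, op_cls]
    congr 1
    apply Subtype.ext
    simp only [diff, Submodule.coe_add, Submodule.coe_smul, AddSubgroupClass.coe_sub]
    match_scalars <;> first
      | ring1
      | linear_combination Lam.t_mul_tInv
      | linear_combination -Lam.t_mul_tInv
      | linear_combination -(1 - Lam.t) * Lam.t_mul_tInv
  fix := S.op_self _

theorem isAbelian : Rack.IsAbelian S.Carrier := fun x y z w => S.op_medial w z y x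

/-- The map `N / Xᵢ → M`, `x + Xᵢ ↦ (1 - t) x`. -/
noncomputable def oneSubTCoe (i : I) : (S.N ⧸ S.X i) →ₗ[Lam] M :=
  (S.X i).liftQ (S.N.subtype ∘ₗ LinearMap.lsmul Lam S.N (1 - Lam.t)) fun x hx => by
    have h := S.smul_eq_zero i x hx
    rw [LinearMap.mem_ker, LinearMap.comp_apply, LinearMap.lsmul_apply, h, map_zero]

/-- The natural map `Q(N, (mᵢ), (Xᵢ)) → M`, `x ↦ mᵢ + (1 - t) x` for `x ∈ Qᵢ`, into the standard
Alexander quandle on `M`. -/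
noncomputable def naturalMap : S.Carrier →◃ AlexanderQuandle M where
  toFun x := (S.m x.1 + S.oneSubTCoe x.1 x.2 : M)
  map_act' {y x} := by
    obtain ⟨i, x, rfl⟩ := S.exists_cls x
    obtain ⟨j, y, rfl⟩ := S.exists_cls y
    change (S.m i + (((1 - Lam.t) • (S.diff i j + Lam.t • x + (1 - Lam.t) • y) : S.N) : M) : M) =
      Lam.t • (S.m i + (((1 - Lam.t) • x : S.N) : M)) +
        (1 - Lam.t) • (S.m j + (((1 - Lam.t) • y : S.N) : M))
    simp only [diff, Submodule.coe_add, Submodule.coe_smul]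
    module

theorem naturalMap_cls (i : I) (x : S.N) :
    S.naturalMap (S.cls i x) = (S.m i + (1 - Lam.t) • (x : M) : M) := rfl

/-- The image of the natural map, a subquandle of the standard Alexander quandle on `M`. -/
def NaturalImage : Type _ := Set.range S.naturalMap

noncomputable instance : Quandle S.NaturalImage := ShelfHom.rangeQuandle S.naturalMap

/-- The inclusion of the image of the natural map in the module `M`. -/
def NaturalImage.val {S : MedialData I M} (x : S.NaturalImage) : M := Subtype.val x

/-- The image of the natural map is the union of the cosets `mᵢ + (1 - t) N`. -/
theorem mem_range_naturalMap (z : M) :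
    (∃ q : S.Carrier, S.naturalMap q = z) ↔ ∃ i, ∃ x ∈ S.N, z = S.m i + (1 - Lam.t) • x := by
  constructor
  · rintro ⟨q, rfl⟩
    obtain ⟨i, x, rfl⟩ := S.exists_cls q
    exact ⟨i, x, x.2, rfl⟩
  · rintro ⟨i, x, hx, rfl⟩
    exact ⟨S.cls i ⟨x, hx⟩, rfl⟩

end MedialData

/-! ## Diagrams of oriented virtual links -/

/-- A diagram of an oriented virtual link with components `K₁, …, K_μ`, given by its Gauss diagram.
There are `n` classical crossings.  Travelling along the oriented components, one meets each
classical crossing `c` twice: once on the overpassing strand, in the passage `(c, true)`, and once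
on the underpassing strand, in the passage `(c, false)`.
Virtual crossings leave no trace in a Gauss diagram. -/
structure VirtualLinkDiagram (μ : ℕ) where
  /-- The number of classical crossings. -/
  n : ℕ
  /-- The writhe of each classical crossing. -/
  writhe : Fin n → ℤˣ
  /-- The passage that follows a given passage on the same oriented component. -/
  next : Equiv.Perm (Fin n × Bool)
  /-- The component on which a passage lies. -/
  comp : Fin n × Bool → Fin μ
  /-- The passages on one component form a single cycle.
  (A component may also have no passages at all.) -/
  comp_eq_iff : ∀ p q, comp p = comp q ↔ next.SameCycle p q

namespace VirtualLinkDiagram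

variable {μ : ℕ} (D : VirtualLinkDiagram μ)

/-- The set `C(D)` of classical crossings. -/
abbrev Crossing : Type := Fin D.n

/-- The edges of the diagram: one for each passage `p`, leading from `p` to the next passage, and
one for each component without classical crossings. -/
abbrev Edge : Type := (D.Crossing × Bool) ⊕ {i : Fin μ // ∀ p, D.comp p ≠ i}

/-- Two edges are joined at an overpass: the edge that arrives at the overpassing strand of a
classical crossing, and the edge that leaves it. -/
inductive Join : D.Edge → D.Edge → Prop
  | over (c : D.Crossing) :
      Join (.inl (D.next.symm (c, true))) (.inl (c, true))

/-- The set `A(D)` of arcs: the pieces into which the components are cut at the underpasses. -/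
def Arc : Type := Quot D.Join

/-- The arc that contains a given edge. -/
def arc (e : D.Edge) : D.Arc := Quot.mk _ e

theorem comp_next (p : D.Crossing × Bool) : D.comp (D.next p) = D.comp p :=
  (D.comp_eq_iff _ _).2 (Equiv.Perm.sameCycle_apply_left.2 (Equiv.Perm.SameCycle.refl _ _))

theorem comp_next_symm (p : D.Crossing × Bool) : D.comp (D.next.symm p) = D.comp p := by
  rw [← D.comp_next, Equiv.apply_symm_apply]

/-- The index `κ(a)` of the component on which an arc lies. -/
def kappa : D.Arc → Fin μ :=
  Quot.lift (Sum.elim D.comp Subtype.val) (by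
    rintro _ _ ⟨c⟩
    exact D.comp_next_symm _)

/-- The overpassing arc `a(c)` of a classical crossing. -/
def a (c : D.Crossing) : D.Arc := D.arc (.inl (c, true))

/-- The underpassing arc that arrives at a classical crossing. -/
def inArc (c : D.Crossing) : D.Arc := D.arc (.inl (D.next.symm (c, false)))

/-- The underpassing arc that leaves a classical crossing. -/
def outArc (c : D.Crossing) : D.Arc := D.arc (.inl (c, false))

/-- The underpassing arc `b₁(c)` on the right side of the overpassing arc.  At a crossing of
writhe `1` the understrand crosses the overstrand from right to left, and at a crossing of writhe
`-1` from left to right. -/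
def b₁ (c : D.Crossing) : D.Arc := if D.writhe c = 1 then D.inArc c else D.outArc c

/-- The underpassing arc `b₂(c)` on the left side of the overpassing arc. -/
def b₂ (c : D.Crossing) : D.Arc := if D.writhe c = 1 then D.outArc c else D.inArc c

theorem kappa_inArc (c : D.Crossing) : D.kappa (D.inArc c) = D.comp (c, false) :=
  D.comp_next_symm _

theorem kappa_outArc (c : D.Crossing) : D.kappa (D.outArc c) = D.comp (c, false) := rfl

theorem kappa_b₁ (c : D.Crossing) : D.kappa (D.b₁ c) = D.comp (c, false) := by
  unfold b₁
  split_ifs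
  · exact D.kappa_inArc c
  · exact D.kappa_outArc c

theorem kappa_b₂ (c : D.Crossing) : D.kappa (D.b₂ c) = D.comp (c, false) := by
  unfold b₂
  split_ifs
  · exact D.kappa_outArc c
  · exact D.kappa_inArc c

/-! ### The medial quandle of a link -/

/-- The crossing relations `q_{b₂(c)} = q_{b₁(c)} ▷ q_{a(c)}`. -/
inductive CrossingRel : QuandleTerm D.Arc → QuandleTerm D.Arc → Prop
  | crossing (c : D.Crossing) :
      CrossingRel (.gen (D.b₂ c)) (.act (.gen (D.a c)) (.gen (D.b₁ c)))

/-- The medial quandle `MQ(L)`: generators `q_a` for the arcs `a`, with the crossing relations. -/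
abbrev MQ : Type := PresentedMedialQuandle D.CrossingRel

/-- The generator `q_a` of the medial quandle. -/
def q (x : D.Arc) : D.MQ := PresentedMedialQuandle.of D.CrossingRel x

/-! ### The reduced Alexander module -/

/-- The map `ϱ : Λ^{C(D)} → Λ^{A(D)}`, `c ↦ (1 - t) a(c) + t b₁(c) - b₂(c)`. -/
noncomputable def rho : (D.Crossing →₀ Lam) →ₗ[Lam] (D.Arc →₀ Lam) :=
  Finsupp.linearCombination Lam fun c =>
    Finsupp.single (D.a c) (1 - Lam.t) + Finsupp.single (D.b₁ c) Lam.t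
      - Finsupp.single (D.b₂ c) 1

/-- The reduced Alexander module, the cokernel of `ϱ`. -/
abbrev RedAlexander : Type := (D.Arc →₀ Lam) ⧸ LinearMap.range D.rho

/-- The canonical map `ς : Λ^{A(D)} → M_A^red(L)`. -/
noncomputable def sigma : (D.Arc →₀ Lam) →ₗ[Lam] D.RedAlexander :=
  (LinearMap.range D.rho).mkQ

/-- The element of `M_A^red(L)` represented by an arc. -/
noncomputable def arcClass (x : D.Arc) : D.RedAlexander := D.sigma (Finsupp.single x 1)

theorem arc_hom_eq_zero {P : Type*} [AddCommGroup P] [Module Lam P] (v : D.Arc → P)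
    (hv : ∀ c, (1 - Lam.t) • v (D.a c) + Lam.t • v (D.b₁ c) - v (D.b₂ c) = 0) :
    LinearMap.range D.rho ≤ LinearMap.ker (Finsupp.linearCombination Lam v) := by
  rintro _ ⟨x, rfl⟩
  induction x using Finsupp.induction_linear with
  | zero => simp
  | add x y hx hy => rw [map_add]; exact Submodule.add_mem _ hx hy
  | single c r =>
    rw [LinearMap.mem_ker]
    rw [rho, Finsupp.linearCombination_single, map_smul, map_sub, map_add]
    simp only [Finsupp.linearCombination_single, one_smul, hv c, smul_zero]

/-- The map `φ_L^red : M_A^red(L) → Λ` that sends every arc to `1`. -/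
noncomputable def phiRed : D.RedAlexander →ₗ[Lam] Lam :=
  (LinearMap.range D.rho).liftQ (Finsupp.linearCombination Lam fun _ => (1 : Lam))
    (D.arc_hom_eq_zero _ fun c => by simp)

/-- The module `A_μ = Λ ⊕ ℤ^{μ-1}`, with trivial action of `t` on the coordinates in `ℤ`.  These
coordinates are indexed by all components but the first one. -/
abbrev AMod (μ : ℕ) : Type := Lam × ({j : Fin μ // j.val ≠ 0} → TrivInt)

/-- The image of an arc in `A_μ`: the first coordinate is `1`, and so is the coordinate that belongs
to the component of the arc, unless this is the first component. -/
noncomputable def arcVec (x : D.Arc) : AMod μ :=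
  (1, fun j => if D.kappa x = j.val then TrivInt.one else 0)

/-- The map `φ_τ : M_A^red(L) → A_μ`. -/
noncomputable def phiTau : D.RedAlexander →ₗ[Lam] AMod μ :=
  (LinearMap.range D.rho).liftQ (Finsupp.linearCombination Lam D.arcVec)
    (D.arc_hom_eq_zero _ fun c => by
      ext j
      · simp [arcVec]
      · simp [arcVec, sub_smul, TrivInt.t_smul, kappa_b₁, kappa_b₂])

theorem phiRed_arcClass (x : D.Arc) : D.phiRed (D.arcClass x) = 1 := by
  simp [phiRed, arcClass, sigma]

theorem phiTau_arcClass (x : D.Arc) : D.phiTau (D.arcClass x) = D.arcVec x := by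
  simp [phiTau, arcClass, sigma]

/-- `φ_L^red` is the first coordinate of `φ_τ`. -/
theorem phiTau_fst (x : D.RedAlexander) : (D.phiTau x).1 = D.phiRed x := by
  have h : LinearMap.fst Lam Lam _ ∘ₗ D.phiTau = D.phiRed := by
    apply Submodule.linearMap_qext
    ext x
    simp [phiTau, phiRed, arcVec]
  exact LinearMap.congr_fun h x

/-! ### Meridians and longitudes -/

/-- The set `M_i(L)` of meridians of the component `K_i` in `M_A^red(L)`. -/
def meridians (i : Fin μ) : Set D.RedAlexander :=
  {x | ∃ y : D.Arc, D.kappa y = i ∧ D.phiTau x = D.phiTau (D.arcClass y)}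

theorem phiRed_meridian {i : Fin μ} {x : D.RedAlexander} (hx : x ∈ D.meridians i) :
    D.phiRed x = 1 := by
  obtain ⟨y, -, hy⟩ := hx
  rw [← phiTau_fst, hy, phiTau_fst, phiRed_arcClass]

/-- The crossings at which the component `K_i` passes under. -/
def underCrossings (i : Fin μ) : Finset D.Crossing :=
  Finset.univ.filter fun c => D.kappa (D.b₁ c) = i

/-- The integral chain `∑ w(c) a(c)`, summed over the crossings with `κ(b₁(c)) = i`. -/
noncomputable def overSum (i : Fin μ) : D.Arc →₀ ℤ :=
  ∑ c ∈ D.underCrossings i, Finsupp.single (D.a c) (D.writhe c : ℤ)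

/-- The integral chain `∑ w(c) (b₁(c) + b₂(c))`, summed over the crossings with
`κ(b₁(c)) = i`. -/
noncomputable def underSum (i : Fin μ) : D.Arc →₀ ℤ :=
  ∑ c ∈ D.underCrossings i,
    (Finsupp.single (D.b₁ c) (D.writhe c : ℤ) + Finsupp.single (D.b₂ c) (D.writhe c : ℤ))

/-- One half of `underSum`, all of whose coefficients are even by `two_smul_halfUnderSum`. -/
noncomputable def halfUnderSum (i : Fin μ) : D.Arc →₀ ℤ :=
  (D.underSum i).mapRange (fun k => k / 2) (by simp)

/-- The integral chain `∑ w(c) a(c) - ½ ∑ w(c) (b₁(c) + b₂(c))`. -/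
noncomputable def longitudeChain (i : Fin μ) : D.Arc →₀ ℤ := D.overSum i - D.halfUnderSum i

/-- The inclusion `ℤ^{A(D)} → Λ^{A(D)}`. -/
noncomputable def toLam : (D.Arc →₀ ℤ) →+ (D.Arc →₀ Lam) :=
  Finsupp.mapRange.addMonoidHom (Int.castAddHom Lam)

/-- On each component, the arcs arriving at underpasses are the arcs leaving underpasses. -/
theorem sum_inArc (i : Fin μ) :
    ∑ c ∈ D.underCrossings i, Finsupp.single (D.inArc c) (1 : ℤ) =
      ∑ c ∈ D.underCrossings i, Finsupp.single (D.outArc c) (1 : ℤ) := by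
  let f : D.Crossing × Bool → (D.Arc →₀ ℤ) := fun p =>
    if D.comp p = i then Finsupp.single (D.arc (.inl p)) 1 else 0
  have h : ∑ p, f (D.next.symm p) = ∑ p, f p := Equiv.sum_comp D.next.symm f
  rw [Fintype.sum_prod_type, Fintype.sum_prod_type] at h
  simp only [Fintype.sum_bool, Finset.sum_add_distrib] at h
  have h' : ∀ c, f (D.next.symm (c, true)) = f (c, true) := fun c => by
    have e : D.arc (.inl (D.next.symm (c, true))) = D.arc (.inl (c, true)) :=
      Quot.sound (Join.over c)
    simp only [f, comp_next_symm, e]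
  simp only [h', add_right_inj] at h
  simp only [underCrossings, Finset.sum_filter, kappa_b₁]
  simpa only [f, comp_next_symm, inArc, outArc] using h

theorem sum_writhe (i : Fin μ) :
    ∑ c ∈ D.underCrossings i, Finsupp.single (D.b₂ c) (D.writhe c : ℤ) =
      ∑ c ∈ D.underCrossings i, Finsupp.single (D.b₁ c) (D.writhe c : ℤ) := by
  have h := D.sum_inArc i
  rw [eq_comm, ← sub_eq_zero, ← Finset.sum_sub_distrib] at h
  rw [← sub_eq_zero, ← Finset.sum_sub_distrib, ← h]
  refine Finset.sum_congr rfl fun c _ => ?_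
  rcases Int.units_eq_one_or (D.writhe c) with hc | hc
  · simp [b₁, b₂, hc]
  · have : ((-1 : ℤˣ) = 1) = False := by simp
    simp only [b₁, b₂, hc, this, if_false]
    simp only [Units.val_neg, Units.val_one, Finsupp.single_neg]
    abel

theorem underSum_eq (i : Fin μ) :
    D.underSum i = 2 • ∑ c ∈ D.underCrossings i, Finsupp.single (D.b₁ c) (D.writhe c : ℤ) := by
  rw [underSum, Finset.sum_add_distrib, sum_writhe, two_nsmul]

theorem halfUnderSum_eq (i : Fin μ) :
    D.halfUnderSum i = ∑ c ∈ D.underCrossings i, Finsupp.single (D.b₁ c) (D.writhe c : ℤ) := by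
  ext x
  rw [halfUnderSum, underSum_eq]
  simp

theorem two_smul_halfUnderSum (i : Fin μ) : 2 • D.halfUnderSum i = D.underSum i := by
  rw [halfUnderSum_eq, underSum_eq]

theorem longitudeChain_eq (i : Fin μ) : D.longitudeChain i =
    ∑ c ∈ D.underCrossings i,
      (Finsupp.single (D.a c) (D.writhe c : ℤ) - Finsupp.single (D.b₁ c) (D.writhe c : ℤ)) := by
  rw [longitudeChain, halfUnderSum_eq, overSum, Finset.sum_sub_distrib]

theorem phiRed_longitude (i : Fin μ) :
    D.phiRed (D.sigma (D.toLam (D.longitudeChain i))) = 0 := by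
  rw [longitudeChain_eq]
  rw [map_sum, map_sum, map_sum]
  refine Finset.sum_eq_zero fun c _ => ?_
  rw [map_sub]
  simp [phiRed, sigma, toLam]

theorem smul_longitude (i : Fin μ) :
    (1 - Lam.t) • D.sigma (D.toLam (D.longitudeChain i)) = 0 := by
  have h : (1 - Lam.t) • D.toLam (D.longitudeChain i) =
      D.rho (∑ c ∈ D.underCrossings i, Finsupp.single c ((D.writhe c : ℤ) : Lam)) := by
    have h₂ := congrArg D.toLam (D.sum_writhe i)
    rw [longitudeChain_eq]
    simp only [toLam, map_sum, map_sub, Finsupp.mapRange.addMonoidHom_apply,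
      Finsupp.mapRange_single, Int.coe_castAddHom, rho, Finsupp.linearCombination_single] at h₂ ⊢
    simp only [smul_sub, smul_add, Finset.sum_sub_distrib, Finset.sum_add_distrib,
      Finsupp.smul_single, smul_eq_mul, mul_one, h₂, Finset.smul_sum]
    have e : ∀ c : D.Crossing, Finsupp.single (D.b₁ c) ((1 - Lam.t) * ((D.writhe c : ℤ) : Lam)) =
        Finsupp.single (D.b₁ c) ((D.writhe c : ℤ) : Lam) -
          Finsupp.single (D.b₁ c) (((D.writhe c : ℤ) : Lam) * Lam.t) := fun c => by
      rw [← Finsupp.single_sub]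
      congr 1
      ring
    simp only [e, Finset.sum_sub_distrib]
    simp only [mul_comm (1 - Lam.t)]
    abel
  rw [← map_smul, h]
  exact (Submodule.Quotient.mk_eq_zero _).2 ⟨_, rfl⟩

/-- The longitude `χ_i(L) = ς(∑ w(c) a(c) - ½ ∑ w(c) (b₁(c) + b₂(c)))` of the component `K_i`, where
both sums range over the crossings with `κ(b₁(c)) = i`, as an element of the kernel of
`φ_L^red`. -/
noncomputable def longitude (i : Fin μ) : LinearMap.ker D.phiRed :=
  ⟨D.sigma (D.toLam (D.longitudeChain i)), D.phiRed_longitude i⟩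

/-- The submodule `X_i` of the kernel of `φ_L^red` generated by the longitude `χ_i(L)`. -/
noncomputable def longitudeSpan (i : Fin μ) : Submodule Lam (LinearMap.ker D.phiRed) :=
  Submodule.span Lam {D.longitude i}

/-- The data `(ker φ_L^red, m₁, …, m_μ, X₁, …, X_μ)`, for a choice of meridians `m_i ∈ M_i(L)`. -/
noncomputable def medialData (m : Fin μ → D.RedAlexander) (hm : ∀ i, m i ∈ D.meridians i) :
    MedialData (Fin μ) D.RedAlexander where
  N := LinearMap.ker D.phiRed
  m := m
  X := D.longitudeSpan
  sub_mem i j := by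
    rw [LinearMap.mem_ker, map_sub, D.phiRed_meridian (hm i), D.phiRed_meridian (hm j), sub_self]
  smul_eq_zero i x hx := by
    obtain ⟨r, rfl⟩ := Submodule.mem_span_singleton.1 hx
    rw [smul_comm]
    have h : (1 - Lam.t) • D.longitude i = 0 := Subtype.ext (D.smul_longitude i)
    rw [h, smul_zero]

/-- The quandle `Q_A^red(L) = ⋃ᵢ (mᵢ + (1 - t) ker φ_L^red)`, the image of the natural map
`x ↦ mᵢ + (1 - t) x`. -/
abbrev QARed (m : Fin μ → D.RedAlexander) (hm : ∀ i, m i ∈ D.meridians i) : Type :=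
  (D.medialData m hm).NaturalImage

end VirtualLinkDiagram

/-! The isomorphism `e` is `value`, the quandle map MQ(L) → M with q_a ↦ ς(a); the work lies in its
injectivity. In a medial quandle the transvections β_y β_z⁻¹ commute (`transvections_comm`), and
conjugation by a fixed β_o makes them a Λ-module. The map x ↦ β_x β_o⁻¹ is a quandle map to the
Alexander quandle of this module (`of_act`), so it factors through M (`toTrans_value`). Thus M acts
on MQ(L) by commuting permutations, and h ∈ ker φ changes values by (1 - t)h (`value_perm`).

The orbits of ker φ correspond to the components, and φ_τ of the value tells them apart
(`sameOrbit_of_value_eq`). So two elements with the same value differ by the action of some h ∈ ker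
φ with (1 - t)h = 0. Such an h is an integral combination of longitudes (`exists_eq_sum_longitude`),
by an augmentation argument on chains. Travelling once around K_i shows that χ_i fixes the
generators q_a with a on K_i, hence the whole orbit (`perm_eq_of_mem_longitudeSpan`). If all X_i
agree, then h lies in the submodule that acts trivially on the orbit in question, and the two
elements coincide.

The kernel of φ_τ is (1 - t) ker φ, so the meridians of K_i form a coset of it and the values fill
exactly Q_A^red(L) (`range_value_eq`). The same description of the annihilator of 1 - t makes f
injective (`naturalMap_injective`), and g is f⁻¹ after `e`. -/

/-! ## Modules over the ring of Laurent polynomials -/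

namespace Lam

/-- An additive subgroup stable under `t` and `t⁻¹` is stable under `Λ`. -/
theorem smul_mem_of_stable {P : Type*} [AddCommGroup P] [Module Lam P] (S : AddSubgroup P)
    (ht : ∀ x ∈ S, t • x ∈ S) (ht' : ∀ x ∈ S, tInv • x ∈ S) (r : Lam) {x : P} (hx : x ∈ S) :
    r • x ∈ S := by
  induction r using LaurentPolynomial.induction_on with
  | h_C a =>
    have h : (LaurentPolynomial.C a : Lam) = (a : Lam) := by simp
    rw [h, Int.cast_smul_eq_zsmul]
    exact S.zsmul_mem hx a
  | h_add hp hq => rw [add_smul]; exact S.add_mem hp hq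
  | h_C_mul_T n a h =>
    rw [LaurentPolynomial.T_add, ← mul_assoc, mul_comm, mul_smul]
    exact ht _ h
  | h_C_mul_T_Z n a h =>
    rw [sub_eq_add_neg, LaurentPolynomial.T_add, ← mul_assoc, mul_comm, mul_smul]
    exact ht' _ h

theorem aug_tInv : aug tInv = 1 := by
  have h := congrArg aug tInv_mul_t
  rwa [map_mul, aug_t, mul_one, map_one] at h

/-- The augmentation is the reduction modulo `1 - t`. -/
theorem dvd_sub_aug (r : Lam) : 1 - t ∣ r - (aug r : Lam) := by
  -- The elements congruent to their augmentation modulo 1 - t: a subgroup stable under t and t⁻¹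
  -- that contains 1, hence all of Λ.
  let S : AddSubgroup Lam :=
    (Ideal.span {1 - t}).toAddSubgroup.comap
      (AddMonoidHom.id Lam - (Int.castAddHom Lam).comp aug.toAddMonoidHom)
  have hS : ∀ x, x ∈ S ↔ 1 - t ∣ x - (aug x : Lam) := fun x => Ideal.mem_span_singleton
  have h := smul_mem_of_stable S (fun x hx => ?_) (fun x hx => ?_) r (x := 1) ?_
  · rwa [smul_eq_mul, mul_one, hS] at h
  · rw [hS] at hx ⊢
    rw [smul_eq_mul, map_mul, aug_t, one_mul]
    obtain ⟨s, hs⟩ := hx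
    exact ⟨s - x, by linear_combination hs⟩
  · rw [hS] at hx ⊢
    rw [smul_eq_mul, map_mul, aug_tInv, one_mul]
    obtain ⟨s, hs⟩ := hx
    exact ⟨s + tInv * x, by linear_combination hs + x * tInv_mul_t⟩
  · rw [hS]
    simp

theorem one_sub_t_ne_zero : (1 - t : Lam) ≠ 0 := by
  rw [sub_ne_zero, t, ← LaurentPolynomial.T_zero]
  intro h
  have := congrArg LaurentPolynomial.degree h
  rw [LaurentPolynomial.degree_T, LaurentPolynomial.degree_T] at this
  exact absurd this (by decide)

/-- The difference r - aug r is a multiple of 1 - t, which kills x. Hence Λx consists of the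
integral multiples of x; this is applied to longitudes. -/
theorem smul_eq_aug_smul {P : Type*} [AddCommGroup P] [Module Lam P] {x : P} (hx : t • x = x)
    (r : Lam) : r • x = aug r • x := by
  obtain ⟨s, hs⟩ := dvd_sub_aug r
  rw [← Int.cast_smul_eq_zsmul Lam, ← sub_eq_zero, ← sub_smul, hs, mul_comm, mul_smul, sub_smul,
    one_smul, hx, sub_self, smul_zero]

/-- The `Λ`-module structure in which `t` acts by an invertible endomorphism. -/
@[reducible]
noncomputable def moduleOfUnit {A : Type*} [AddCommGroup A] (u : (AddMonoid.End A)ˣ) :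
    Module Lam A :=
  -- Λ is the group ring of ℤ, so the homomorphism n ↦ uⁿ extends to a ring map Λ → End(A).
  Module.compHom A (AddMonoidAlgebra.lift ℤ (AddMonoid.End A) ℤ
    ((Units.coeHom _).comp (zpowersHom _ u))).toRingHom

theorem moduleOfUnit_t_smul {A : Type*} [AddCommGroup A] (u : (AddMonoid.End A)ˣ) (x : A) :
    letI := moduleOfUnit u
    t • x = (u : AddMonoid.End A) x := by
  change AddMonoidAlgebra.lift ℤ (AddMonoid.End A) ℤ _ (AddMonoidAlgebra.single 1 1) x = _
  rw [AddMonoidAlgebra.lift_single]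
  simp

end Lam

namespace TrivInt

/-- The linear map from the trivial module `ℤ` given by an element fixed by `t`. -/
noncomputable def toFixed {P : Type*} [AddCommGroup P] [Module Lam P] (x : P)
    (hx : Lam.t • x = x) : TrivInt →ₗ[Lam] P where
  toFun n := (show ℤ from n) • x
  map_add' n k := add_smul (show ℤ from n) (show ℤ from k) x
  map_smul' r n := by
    rw [RingHom.id_apply, smul_comm, Lam.smul_eq_aug_smul hx]
    change (Lam.aug r * (show ℤ from n)) • x = _
    rw [mul_comm, mul_smul]

theorem toFixed_one {P : Type*} [AddCommGroup P] [Module Lam P] (x : P) (hx : Lam.t • x = x) :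
    toFixed x hx one = x := one_smul ℤ x

theorem one_ne_zero : one ≠ 0 := Int.one_ne_zero

end TrivInt

/-! ## Transvections of medial quandles -/

namespace Rack

/-- The medial law is an identity between products of two translations; expand β_{x ◃ y} = β_x β_y
β_x⁻¹ and cancel β_x on the left. -/
theorem IsAbelian.act'_mul_inv_mul {Q : Type*} [Rack Q] (hQ : IsAbelian Q) (x y z : Q) :
    act' y * (act' x)⁻¹ * act' z = act' z * (act' x)⁻¹ * act' y := by
  have h : act' (x ◃ y) * act' z = act' (x ◃ z) * act' y := by
    ext w
    exact hQ x y z w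
  simp only [ad_conj] at h
  have := congrArg ((act' x)⁻¹ * ·) h
  simpa [mul_assoc] using this

variable (Q : Type*) [Rack Q]

/-- The group of transvections (or displacements), generated by the permutations
`β_y β_z⁻¹`. -/
def transvectionGroup : Subgroup (Equiv.Perm Q) :=
  Subgroup.closure {g | ∃ y z : Q, g = act' y * (act' z)⁻¹}

variable {Q}

theorem act'_mul_inv_mem (y z : Q) : act' y * (act' z)⁻¹ ∈ transvectionGroup Q :=
  Subgroup.subset_closure ⟨y, z, rfl⟩

theorem conj_mem_transvectionGroup (x : Q) {g : Equiv.Perm Q} (hg : g ∈ transvectionGroup Q) :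
    act' x * g * (act' x)⁻¹ ∈ transvectionGroup Q := by
  have h : transvectionGroup Q ≤ (transvectionGroup Q).comap (MulAut.conj (act' x)).toMonoidHom := by
    refine (Subgroup.closure_le _).2 ?_
    rintro _ ⟨y, z, rfl⟩
    have := act'_mul_inv_mem (x ◃ y) (x ◃ z)
    rw [ad_conj, ad_conj] at this
    simpa [mul_assoc] using this
  exact h hg

theorem inv_conj_mem_transvectionGroup (x : Q) {g : Equiv.Perm Q}
    (hg : g ∈ transvectionGroup Q) : (act' x)⁻¹ * g * act' x ∈ transvectionGroup Q := by
  have h : transvectionGroup Q ≤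
      (transvectionGroup Q).comap (MulAut.conj (act' x)⁻¹).toMonoidHom := by
    refine (Subgroup.closure_le _).2 ?_
    rintro _ ⟨y, z, rfl⟩
    have := act'_mul_inv_mem (x ◃⁻¹ y) (x ◃⁻¹ z)
    have e : ∀ w, act' (x ◃⁻¹ w) = (act' x)⁻¹ * act' w * act' x := fun w => by
      have := ad_conj x (x ◃⁻¹ w)
      rw [right_inv] at this
      rw [this]
      group
    rw [e, e] at this
    simpa [mul_assoc] using this
  simpa using h hg

/-- In β_y β_x⁻¹ β_z β_w⁻¹ the medial law allows y and z to be exchanged, and its inverse form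
allows x and w to be exchanged. Together these two moves commute the generators. -/
theorem IsAbelian.transvections_comm (hQ : IsAbelian Q) {g h : Equiv.Perm Q}
    (hg : g ∈ transvectionGroup Q) (hh : h ∈ transvectionGroup Q) : g * h = h * g := by
  have key : ∀ x y z w : Q, act' y * (act' x)⁻¹ * (act' z * (act' w)⁻¹) =
      act' z * (act' w)⁻¹ * (act' y * (act' x)⁻¹) := fun x y z w => by
    have h₁ := hQ.act'_mul_inv_mul x y z
    have h₂ := hQ.act'_mul_inv_mul w z y
    have h₃ : (act' x)⁻¹ * act' y * (act' w)⁻¹ = (act' w)⁻¹ * act' y * (act' x)⁻¹ := by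
      have := congrArg (·⁻¹) (show (act' w) * (act' y)⁻¹ * act' x = act' x * (act' y)⁻¹ * act' w from
        hQ.act'_mul_inv_mul y w x)
      simpa [mul_assoc] using this
    calc act' y * (act' x)⁻¹ * (act' z * (act' w)⁻¹)
        = (act' y * (act' x)⁻¹ * act' z) * (act' w)⁻¹ := by group
      _ = act' z * ((act' x)⁻¹ * act' y * (act' w)⁻¹) := by rw [h₁]; group
      _ = act' z * (act' w)⁻¹ * (act' y * (act' x)⁻¹) := by rw [h₃]; group
  -- Commutation passes from generators to the group one factor at a time, through centralizers.
  have hc : transvectionGroup Q ≤ Subgroup.centralizer (transvectionGroup Q) := by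
    refine (Subgroup.closure_le _).2 ?_
    rintro _ ⟨y, x, rfl⟩
    rw [SetLike.mem_coe, transvectionGroup, Subgroup.mem_centralizer_iff]
    intro k hk
    have hc' : transvectionGroup Q ≤ Subgroup.centralizer {act' y * (act' x)⁻¹} := by
      refine (Subgroup.closure_le _).2 ?_
      rintro _ ⟨z, w, rfl⟩
      rw [SetLike.mem_coe, Subgroup.mem_centralizer_singleton_iff]
      exact (key x y z w).symm
    exact Subgroup.mem_centralizer_singleton_iff.1 (hc' hk)
  exact Subgroup.mem_centralizer_iff.1 (hc hh) g hg

/-- The group of transvections of a medial quandle, written additively and regarded as a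
`Λ`-module on which `t` acts as conjugation by the translation `β_o`. -/
def Transvections (_ : IsAbelian Q) (_ : Q) : Type _ := Additive (transvectionGroup Q)

namespace Transvections

variable {hQ : IsAbelian Q} {o : Q}

instance : AddCommGroup (Transvections hQ o) where
  __ := (inferInstance : AddGroup (Additive (transvectionGroup Q)))
  add_comm (a b : transvectionGroup Q) := Subtype.ext (hQ.transvections_comm a.2 b.2)

/-- The permutation given by an element of the module of transvections. -/
def perm (a : Transvections hQ o) : Equiv.Perm Q := Subtype.val a

theorem perm_mem (a : Transvections hQ o) : a.perm ∈ transvectionGroup Q := Subtype.prop a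

theorem perm_injective : Function.Injective (perm : Transvections hQ o → Equiv.Perm Q) :=
  Subtype.val_injective

theorem perm_zero : perm (0 : Transvections hQ o) = 1 := rfl

theorem perm_add (a b : Transvections hQ o) : (a + b).perm = a.perm * b.perm := rfl

theorem perm_neg (a : Transvections hQ o) : (-a).perm = a.perm⁻¹ := rfl

theorem perm_sub (a b : Transvections hQ o) : (a - b).perm = a.perm * b.perm⁻¹ := by
  rw [sub_eq_add_neg, perm_add, perm_neg]

variable (hQ o)

/-- Conjugation by `β_o`. -/
def conj : (AddMonoid.End (Transvections hQ o))ˣ where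
  val := AddMonoidHom.mk' (fun a => (⟨_, conj_mem_transvectionGroup o a.perm_mem⟩ :
      transvectionGroup Q)) fun a b => perm_injective <| by
    change act' o * (a.perm * b.perm) * (act' o)⁻¹ =
      act' o * a.perm * (act' o)⁻¹ * (act' o * b.perm * (act' o)⁻¹)
    group
  inv := AddMonoidHom.mk' (fun a => (⟨_, inv_conj_mem_transvectionGroup o a.perm_mem⟩ :
      transvectionGroup Q)) fun a b => perm_injective <| by
    change (act' o)⁻¹ * (a.perm * b.perm) * act' o =
      (act' o)⁻¹ * a.perm * act' o * ((act' o)⁻¹ * b.perm * act' o)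
    group
  val_inv := by
    ext a : 1
    apply perm_injective
    change act' o * ((act' o)⁻¹ * a.perm * act' o) * (act' o)⁻¹ = a.perm
    group
  inv_val := by
    ext a : 1
    apply perm_injective
    change (act' o)⁻¹ * (act' o * a.perm * (act' o)⁻¹) * act' o = a.perm
    group

noncomputable instance : Module Lam (Transvections hQ o) := Lam.moduleOfUnit (conj hQ o)

variable {hQ o}

theorem perm_t_smul (a : Transvections hQ o) :
    (Lam.t • a).perm = act' o * a.perm * (act' o)⁻¹ :=
  congrArg perm (Lam.moduleOfUnit_t_smul (conj hQ o) a)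

theorem perm_tInv_smul (a : Transvections hQ o) :
    (Lam.tInv • a).perm = (act' o)⁻¹ * a.perm * act' o := by
  have h := perm_t_smul (Lam.tInv • a)
  rw [smul_smul, Lam.t_mul_tInv, one_smul] at h
  rw [h]
  group

variable (hQ o) in
/-- The transvection `β_x β_o⁻¹`. -/
def of (x : Q) : Transvections hQ o :=
  (⟨_, act'_mul_inv_mem x o⟩ : transvectionGroup Q)

theorem perm_of (x : Q) : (of hQ o x).perm = act' x * (act' o)⁻¹ := rfl

theorem of_act (x y : Q) :
    of hQ o (y ◃ x) = Lam.t • of hQ o x + (1 - Lam.t) • of hQ o y := by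
  -- In this order of summands the product of permutations telescopes to β_y β_x β_y⁻¹ β_o⁻¹ by
  -- group axioms alone.
  have e : Lam.t • of hQ o x + (1 - Lam.t) • of hQ o y =
      of hQ o y + Lam.t • of hQ o x - Lam.t • of hQ o y := by module
  rw [e]
  apply perm_injective
  simp only [perm_sub, perm_add, perm_t_smul, perm_of, ad_conj]
  group

end Transvections

end Rack

namespace AlexanderQuandle

variable {M : Type*} [AddCommGroup M] [Module Lam M]

theorem isAbelian : Rack.IsAbelian (AlexanderQuandle M) := by
  intro (x : M) (y : M) (z : M) (w : M)
  change Lam.t • (Lam.t • w + (1 - Lam.t) • z) + (1 - Lam.t) • (Lam.t • y + (1 - Lam.t) • x) =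
    Lam.t • (Lam.t • w + (1 - Lam.t) • y) + (1 - Lam.t) • (Lam.t • z + (1 - Lam.t) • x)
  module

end AlexanderQuandle

theorem ShelfHom.map_invAct {Q R : Type*} [Rack Q] [Rack R] (f : Q →◃ R) (x y : Q) :
    f (x ◃⁻¹ y) = f x ◃⁻¹ f y := by
  rw [← Rack.left_cancel (f x), ← f.map_act]
  simp

/-- An induction principle for the presented medial quandle. -/
theorem PresentedMedialQuandle.induction {G : Type*} {r : QuandleTerm G → QuandleTerm G → Prop}
    {P : PresentedMedialQuandle r → Prop} (of : ∀ g, P (of r g))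
    (act : ∀ y x, P y → P x → P (y ◃ x)) (invAct : ∀ y x, P y → P x → P (y ◃⁻¹ x))
    (q : PresentedMedialQuandle r) : P q := by
  obtain ⟨x, rfl⟩ : ∃ x, mk r x = q := Quotient.exists_rep q
  induction x with
  | gen g => exact of g
  | act y x hy hx => exact act _ _ hy hx
  | invAct y x hy hx => exact invAct _ _ hy hx

/-! ### The action of the reduced Alexander module on MQ(L) -/

namespace VirtualLinkDiagram

open Rack

variable {μ : ℕ} (D : VirtualLinkDiagram μ)

theorem q_b₂ (c : D.Crossing) : D.q (D.b₂ c) = D.q (D.a c) ◃ D.q (D.b₁ c) :=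
  PresentedMedialQuandle.eval_of_eq D.CrossingRel (CrossingRel.crossing c)

theorem arcClass_b₂ (c : D.Crossing) : D.arcClass (D.b₂ c) =
    Lam.t • D.arcClass (D.b₁ c) + (1 - Lam.t) • D.arcClass (D.a c) := by
  rw [eq_comm, ← sub_eq_zero]
  have h : D.sigma (D.rho (Finsupp.single c 1)) = 0 :=
    (Submodule.Quotient.mk_eq_zero _).2 ⟨_, rfl⟩
  have hr : D.rho (Finsupp.single c 1) = Finsupp.single (D.a c) (1 - Lam.t) +
      Finsupp.single (D.b₁ c) Lam.t - Finsupp.single (D.b₂ c) 1 := by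
    rw [rho, Finsupp.linearCombination_single, one_smul]
  rw [hr, map_sub, map_add] at h
  have e : ∀ (x : D.Arc) (r : Lam), D.sigma (Finsupp.single x r) = r • D.arcClass x := fun x r => by
    rw [arcClass, ← map_smul, Finsupp.smul_single, smul_eq_mul, mul_one]
  rw [e, e, e, one_smul] at h
  rw [← h]
  abel

/-- The quandle map `MQ(L) → M_A^red(L)`, `q_a ↦ ς(a)`. -/
noncomputable def toAlexander : D.MQ →◃ AlexanderQuandle D.RedAlexander :=
  PresentedMedialQuandle.lift AlexanderQuandle.isAbelian D.arcClass (by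
    rintro _ _ ⟨c⟩
    exact D.arcClass_b₂ c)

/-- The value in `M_A^red(L)` of an element of `MQ(L)`. -/
noncomputable def value (x : D.MQ) : D.RedAlexander := D.toAlexander x

theorem value_q (x : D.Arc) : D.value (D.q x) = D.arcClass x := rfl

theorem value_act (x y : D.MQ) :
    D.value (y ◃ x) = Lam.t • D.value x + (1 - Lam.t) • D.value y :=
  D.toAlexander.map_act

theorem value_invAct (x y : D.MQ) :
    D.value (y ◃⁻¹ x) = Lam.tInv • D.value x + (1 - Lam.tInv) • D.value y :=
  D.toAlexander.map_invAct y x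

theorem phiRed_value (x : D.MQ) : D.phiRed (D.value x) = 1 := by
  induction x using PresentedMedialQuandle.induction with
  | of a => exact D.phiRed_arcClass a
  | act y x hy hx => simp [value_act, hx, hy]
  | invAct y x hy hx => simp [value_invAct, hx, hy]

theorem isAbelian_MQ : IsAbelian D.MQ := PresentedMedialQuandle.isAbelian _

variable (o : D.MQ)

/-- The module of transvections of `MQ(L)`. -/
abbrev Trans : Type := Transvections D.isAbelian_MQ o

/-- The `Λ`-linear map that sends the value of `x ∈ MQ(L)` to the transvection `β_x β_o⁻¹`. -/
noncomputable def toTrans : D.RedAlexander →ₗ[Lam] D.Trans o :=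
  (LinearMap.range D.rho).liftQ
    (Finsupp.linearCombination Lam fun x => Transvections.of D.isAbelian_MQ o (D.q x))
    (D.arc_hom_eq_zero _ fun c => by
      rw [q_b₂, Transvections.of_act]
      abel)

/-- Both sides are quandle maps into an Alexander quandle, so agreement on the generators q_a
suffices. -/
theorem toTrans_value (x : D.MQ) :
    D.toTrans o (D.value x) = Transvections.of D.isAbelian_MQ o x := by
  let f : D.MQ →◃ AlexanderQuandle (D.Trans o) :=
    { toFun := Transvections.of D.isAbelian_MQ o
      map_act' := Transvections.of_act _ _ }
  let g : D.MQ →◃ AlexanderQuandle (D.Trans o) :=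
    { toFun := fun x => D.toTrans o (D.value x)
      map_act' := by
        intro x y
        rw [value_act, map_add, map_smul, map_smul]
        rfl }
  refine PresentedMedialQuandle.hom_ext (f := g) (f' := f) (fun a => ?_) x
  change D.toTrans o (D.arcClass a) = Transvections.of D.isAbelian_MQ o (D.q a)
  simp [toTrans, arcClass, sigma]

/-- The permutation of `MQ(L)` given by an element of `M_A^red(L)`. -/
noncomputable def perm (h : D.RedAlexander) : Equiv.Perm D.MQ := (D.toTrans o h).perm

theorem perm_zero : D.perm o 0 = 1 := by rw [perm, map_zero, Transvections.perm_zero]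

theorem perm_add (h k : D.RedAlexander) : D.perm o (h + k) = D.perm o h * D.perm o k := by
  rw [perm, map_add, Transvections.perm_add]; rfl

theorem perm_neg (h : D.RedAlexander) : D.perm o (-h) = (D.perm o h)⁻¹ := by
  rw [perm, map_neg, Transvections.perm_neg]; rfl

theorem perm_comm (h k : D.RedAlexander) (x : D.MQ) :
    D.perm o h (D.perm o k x) = D.perm o k (D.perm o h x) := by
  rw [← Equiv.Perm.mul_apply, ← perm_add, add_comm, perm_add, Equiv.Perm.mul_apply]

theorem perm_t_smul (h : D.RedAlexander) :
    D.perm o (Lam.t • h) = act' o * D.perm o h * (act' o)⁻¹ := by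
  rw [perm, map_smul, Transvections.perm_t_smul]; rfl

theorem perm_tInv_smul (h : D.RedAlexander) :
    D.perm o (Lam.tInv • h) = (act' o)⁻¹ * D.perm o h * act' o := by
  rw [perm, map_smul, Transvections.perm_tInv_smul]; rfl

theorem perm_value (x : D.MQ) : D.perm o (D.value x) = act' x * (act' o)⁻¹ := by
  rw [perm, toTrans_value, Transvections.perm_of]

theorem perm_value_sub (x y : D.MQ) :
    D.perm o (D.value x - D.value y) = act' x * (act' y)⁻¹ := by
  rw [sub_eq_add_neg, perm_add, perm_neg, perm_value, perm_value]
  group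

/-- Because β_x fixes x, applying β_y to x is the same as applying the transvection β_y β_x⁻¹. Thus
quandle operations never leave an orbit of ker φ. -/
theorem act_eq_perm (y x : D.MQ) : y ◃ x = D.perm o (D.value y - D.value x) x := by
  rw [perm_value_sub, Equiv.Perm.mul_apply, invAct_apply, act'_apply, Quandle.fix_inv]

theorem invAct_eq_perm (y x : D.MQ) :
    y ◃⁻¹ x = D.perm o (Lam.tInv • (D.value x - D.value y)) x := by
  -- Conjugating β_y⁻¹ β_x by β_y gives β_x β_y⁻¹; mediality lets β_o replace β_y.
  have h : act' x * (act' y)⁻¹ = act' o * ((act' y)⁻¹ * act' x) * (act' o)⁻¹ := by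
    have h₁ := congrArg (·⁻¹) (D.isAbelian_MQ.act'_mul_inv_mul x y o)
    simp only [mul_inv_rev, inv_inv] at h₁
    have h₂ := D.isAbelian_MQ.act'_mul_inv_mul y o x
    rw [eq_mul_inv_iff_mul_eq, ← mul_assoc, h₂]
  rw [perm_tInv_smul, perm_value_sub, h]
  have e : (act' o)⁻¹ * (act' o * ((act' y)⁻¹ * act' x) * (act' o)⁻¹) * act' o =
      (act' y)⁻¹ * act' x := by group
  rw [e, Equiv.Perm.mul_apply, act'_apply, Quandle.fix, invAct_apply]

/-- The permutation given by `h` adds `(1 - t) (h - φ(h) o)` to the value. -/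
theorem value_perm' (h : D.RedAlexander) (x : D.MQ) :
    D.value (D.perm o h x) = D.value x + (1 - Lam.t) • (h - D.phiRed h • D.value o) := by
  -- Since E is linear, the h obeying the formula form a subgroup S. It is stable under t and t⁻¹
  -- because these act by conjugation with β_o, and it contains the arc classes. The correction by
  -- φ(h) reflects that the value of o itself acts as β_o β_o⁻¹ = 1.
  let E : D.RedAlexander →ₗ[Lam] D.RedAlexander :=
    (1 - Lam.t) • (LinearMap.id - D.phiRed.smulRight (D.value o))
  have hE : ∀ h, E h = (1 - Lam.t) • (h - D.phiRed h • D.value o) := fun h => rfl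
  let S : AddSubgroup D.RedAlexander :=
    { carrier := {h | ∀ x, D.value (D.perm o h x) = D.value x + E h}
      zero_mem' := fun x => by rw [perm_zero, map_zero, add_zero]; rfl
      add_mem' := fun {h k} hh hk x => by
        rw [perm_add, Equiv.Perm.mul_apply, hh, hk, map_add]
        abel
      neg_mem' := fun {h} hh x => by
        have := hh (D.perm o (-h) x)
        rw [perm_neg, ← Equiv.Perm.mul_apply, mul_inv_cancel, Equiv.Perm.one_apply] at this
        rw [perm_neg, this, map_neg]
        abel }
  suffices hS : ∀ h, h ∈ S by rw [hS h x, hE]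
  have ht : ∀ h ∈ S, Lam.t • h ∈ S := fun h hh x => by
    rw [perm_t_smul, Equiv.Perm.mul_apply, Equiv.Perm.mul_apply, invAct_apply, act'_apply,
      value_act, hh, value_invAct, map_smul, smul_add, smul_add, smul_smul, smul_smul,
      Lam.t_mul_tInv, mul_sub, Lam.t_mul_tInv]
    module
  have ht' : ∀ h ∈ S, Lam.tInv • h ∈ S := fun h hh x => by
    rw [perm_tInv_smul, Equiv.Perm.mul_apply, Equiv.Perm.mul_apply, invAct_apply, act'_apply,
      value_invAct, hh, value_act, map_smul, smul_add, smul_add, smul_smul, smul_smul,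
      Lam.tInv_mul_t, mul_sub, Lam.tInv_mul_t]
    module
  have hq : ∀ a, D.arcClass a ∈ S := fun a x => by
    rw [hE, ← value_q, perm_value, phiRed_value, Equiv.Perm.mul_apply, invAct_apply, act'_apply,
      value_act, value_invAct, smul_add, smul_smul, smul_smul,
      Lam.t_mul_tInv, mul_sub, Lam.t_mul_tInv]
    module
  intro h
  obtain ⟨ξ, rfl⟩ := (LinearMap.range D.rho).mkQ_surjective h
  induction ξ using Finsupp.induction_linear with
  | zero => rw [map_zero]; exact S.zero_mem
  | add x y hx hy => rw [map_add]; exact S.add_mem hx hy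
  | single a r =>
    have := Lam.smul_mem_of_stable S ht ht' r (hq a)
    rwa [arcClass, ← map_smul, Finsupp.smul_single, smul_eq_mul, mul_one] at this

theorem value_perm {h : D.RedAlexander} (hh : D.phiRed h = 0) (x : D.MQ) :
    D.value (D.perm o h x) = D.value x + (1 - Lam.t) • h := by
  rw [value_perm', hh, zero_smul, sub_zero]

/-! ### Orbits -/

/-- Two elements of `MQ(L)` in the same orbit of the transvections. -/
def SameOrbit (x y : D.MQ) : Prop := ∃ h, D.phiRed h = 0 ∧ D.perm o h x = y

variable {D o}

theorem SameOrbit.refl (x : D.MQ) : D.SameOrbit o x x :=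
  ⟨0, map_zero _, by rw [perm_zero]; rfl⟩

theorem SameOrbit.symm {x y : D.MQ} : D.SameOrbit o x y → D.SameOrbit o y x := by
  rintro ⟨h, hh, rfl⟩
  exact ⟨-h, by rw [map_neg, hh, neg_zero], by rw [perm_neg, ← Equiv.Perm.mul_apply, inv_mul_cancel, Equiv.Perm.one_apply]⟩

theorem SameOrbit.trans {x y z : D.MQ} :
    D.SameOrbit o x y → D.SameOrbit o y z → D.SameOrbit o x z := by
  rintro ⟨h, hh, rfl⟩ ⟨k, hk, rfl⟩
  exact ⟨k + h, by rw [map_add, hh, hk, add_zero], by rw [perm_add]; rfl⟩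

variable (D o)

theorem sameOrbit_act (y x : D.MQ) : D.SameOrbit o x (y ◃ x) :=
  ⟨_, by rw [map_sub, phiRed_value, phiRed_value, sub_self], (D.act_eq_perm o y x).symm⟩

theorem sameOrbit_invAct (y x : D.MQ) : D.SameOrbit o x (y ◃⁻¹ x) :=
  ⟨_, by rw [map_smul, map_sub, phiRed_value, phiRed_value, sub_self, smul_zero],
    (D.invAct_eq_perm o y x).symm⟩

theorem exists_sameOrbit_q (x : D.MQ) : ∃ a, D.SameOrbit o (D.q a) x := by
  induction x using PresentedMedialQuandle.induction with
  | of a => exact ⟨a, .refl _⟩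
  | act y x _ hx => exact hx.imp fun a ha => ha.trans (D.sameOrbit_act o y x)
  | invAct y x _ hx => exact hx.imp fun a ha => ha.trans (D.sameOrbit_invAct o y x)

/-- The generator of `MQ(L)` for the arc that leaves a passage. -/
def qAfter (p : D.Crossing × Bool) : D.MQ := D.q (D.arc (.inl p))

/-- The contribution of a passage to the longitude of its component. -/
noncomputable def turn : D.Crossing × Bool → D.RedAlexander
  | (_, true) => 0
  | (c, false) => (D.writhe c : ℤ) • (D.arcClass (D.a c) - D.arcClass (D.b₁ c))

theorem phiRed_turn (p : D.Crossing × Bool) : D.phiRed (D.turn p) = 0 := by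
  obtain ⟨c, _ | _⟩ := p
  · simp [turn, phiRed_arcClass]
  · simp [turn]

/-- An overpass does not change the arc. At an underpass the crossing relation says that a(c) -
b₁(c) carries b₁ to b₂, and the writhe is the sign that turns this into a move from the arriving arc
to the leaving arc. -/
theorem perm_turn (p : D.Crossing × Bool) :
    D.perm o (D.turn (D.next p)) (D.qAfter p) = D.qAfter (D.next p) := by
  obtain ⟨p, rfl⟩ := D.next.symm.surjective p
  rw [Equiv.apply_symm_apply]
  obtain ⟨c, _ | _⟩ := p
  · change D.perm o (D.turn (c, false)) (D.q (D.inArc c)) = D.q (D.outArc c)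
    have h := D.q_b₂ c
    rw [D.act_eq_perm o, value_q, value_q] at h
    rcases Int.units_eq_one_or (D.writhe c) with hc | hc
    · rw [turn, hc, Units.val_one, one_smul, ← show D.b₁ c = D.inArc c from if_pos hc, ← h]
      exact congrArg _ (if_pos hc)
    · have hc' : ¬ D.writhe c = 1 := by rw [hc]; decide
      have e₁ : D.b₁ c = D.outArc c := if_neg hc'
      have e₂ : D.b₂ c = D.inArc c := if_neg hc'
      rw [turn, hc, Units.val_neg, Units.val_one, neg_smul, one_smul, perm_neg, ← e₂, h,
        ← Equiv.Perm.mul_apply, inv_mul_cancel, Equiv.Perm.one_apply, e₁]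
  · rw [turn, perm_zero]
    exact congrArg D.q (Quot.sound (Join.over c))

/-- The turns of successive passages accumulate. The shift j + 1 is there because `qAfter p` already
lies beyond p, so the turn at p is not counted. -/
theorem perm_sum_turn (p : D.Crossing × Bool) (k : ℕ) :
    D.perm o (∑ j ∈ Finset.range k, D.turn (D.next^[j + 1] p)) (D.qAfter p) =
      D.qAfter (D.next^[k] p) := by
  induction k with
  | zero => rw [Finset.sum_range_zero, perm_zero]; rfl
  | succ k ih =>
    rw [Finset.sum_range_succ, add_comm, perm_add, Equiv.Perm.mul_apply, ih,
      Function.iterate_succ_apply', perm_turn]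

theorem sameOrbit_qAfter {p p' : D.Crossing × Bool} (h : D.comp p = D.comp p') :
    D.SameOrbit o (D.qAfter p) (D.qAfter p') := by
  obtain ⟨k, rfl⟩ := ((D.comp_eq_iff p p').1 h).exists_nat_pow_eq
  rw [← Equiv.Perm.iterate_eq_pow]
  exact ⟨_, by rw [map_sum]; exact Finset.sum_eq_zero fun j _ => D.phiRed_turn _,
    D.perm_sum_turn o p k⟩

/-- Arcs on a component with passages are reached by travelling along it; a component without
passages has a single arc. -/
theorem sameOrbit_q {x y : D.Arc} (h : D.kappa x = D.kappa y) :
    D.SameOrbit o (D.q x) (D.q y) := by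
  obtain ⟨p | ⟨i, hi⟩⟩ := x <;> obtain ⟨p' | ⟨j, hj⟩⟩ := y
  · exact D.sameOrbit_qAfter o h
  · exact absurd h (hj p)
  · exact absurd h.symm (hi p')
  · obtain rfl : i = j := h
    exact .refl _

theorem exists_kappa_eq (i : Fin μ) : ∃ a, D.kappa a = i := by
  by_cases h : ∃ p, D.comp p = i
  · obtain ⟨p, hp⟩ := h
    exact ⟨D.arc (.inl p), hp⟩
  · exact ⟨D.arc (.inr ⟨i, not_exists.1 h⟩), rfl⟩

theorem arcVec_eq_iff {x y : D.Arc} : D.arcVec x = D.arcVec y ↔ D.kappa x = D.kappa y := by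
  refine ⟨fun h => ?_, fun h => by simp only [arcVec, h]⟩
  by_contra hne
  -- Only the first component has no coordinate of its own in A_μ. Arcs with equal vectors on
  -- different components would therefore both lie on the first one.
  have key : ∀ x y : D.Arc, D.arcVec x = D.arcVec y → D.kappa x ≠ D.kappa y →
      (D.kappa x).val = 0 := fun x y h hne => by
    by_contra h0
    have := congrFun (congrArg Prod.snd h) ⟨D.kappa x, h0⟩
    simp only [arcVec, if_true] at this
    rw [if_neg (Ne.symm hne)] at this
    exact TrivInt.one_ne_zero this
  exact hne (Fin.ext ((key x y h hne).trans (key y x h.symm (Ne.symm hne)).symm))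

theorem phiTau_one_sub_t_smul {x : D.RedAlexander} (hx : D.phiRed x = 0) :
    D.phiTau ((1 - Lam.t) • x) = 0 := by
  rw [map_smul]
  ext j
  · rw [Prod.smul_fst, phiTau_fst, hx, smul_zero]; rfl
  · simp [sub_smul, TrivInt.t_smul]

theorem phiTau_value_of_sameOrbit {x : D.MQ} {a : D.Arc} (h : D.SameOrbit o (D.q a) x) :
    D.phiTau (D.value x) = D.arcVec a := by
  obtain ⟨h, hh, rfl⟩ := h
  rw [D.value_perm o hh, map_add, D.phiTau_one_sub_t_smul hh, add_zero, value_q, phiTau_arcClass]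

/-- Elements of `MQ(L)` with the same value lie in the same orbit. -/
theorem sameOrbit_of_value_eq {x y : D.MQ} (h : D.value x = D.value y) : D.SameOrbit o x y := by
  obtain ⟨a, ha⟩ := D.exists_sameOrbit_q o x
  obtain ⟨b, hb⟩ := D.exists_sameOrbit_q o y
  have hab := congrArg D.phiTau h
  rw [D.phiTau_value_of_sameOrbit o ha, D.phiTau_value_of_sameOrbit o hb, arcVec_eq_iff] at hab
  exact ha.symm.trans ((D.sameOrbit_q o hab).trans hb)

end VirtualLinkDiagram

/-- The sum over a full period of a permutation of a finite set is the sum over the cycle. -/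
theorem Equiv.Perm.sum_range_minimalPeriod {α P : Type*} [Fintype α] [DecidableEq α]
    [AddCommMonoid P] (f : Equiv.Perm α) (x : α) (s : Finset α) (hs : ∀ y, y ∈ s ↔ f.SameCycle x y)
    (u : α → P) :
    ∑ j ∈ Finset.range (Function.minimalPeriod f x), u (f^[j + 1] x) = ∑ y ∈ s, u y := by
  have hx : x ∈ Function.periodicPts f :=
    Function.Injective.mem_periodicPts f.injective x
  have hpos := Function.minimalPeriod_pos_of_mem_periodicPts hx
  -- Shifting the exponents from 1, …, period to 0, …, period - 1 is harmless, as the last iterate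
  -- returns to x.
  have h₁ : ∑ j ∈ Finset.range (Function.minimalPeriod f x), u (f^[j + 1] x) =
      ∑ j ∈ Finset.range (Function.minimalPeriod f x), u (f^[j] x) := by
    obtain ⟨k, hk⟩ := Nat.exists_eq_succ_of_ne_zero hpos.ne'
    rw [hk, Finset.sum_range_succ, Finset.sum_range_succ']
    congr 2
    change f^[k.succ] x = x
    rw [← hk, Function.iterate_minimalPeriod]
  rw [h₁]
  refine Finset.sum_nbij (fun j => f^[j] x) (fun j _ => ?_) (fun j hj k hk h => ?_)
    (fun y hy => ?_) fun _ _ => rfl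
  · rw [hs, Equiv.Perm.iterate_eq_pow]
    exact ⟨j, by simp⟩
  · rw [Finset.coe_range] at hj hk
    exact Function.iterate_injOn_Iio_minimalPeriod hj hk h
  · obtain ⟨k, hk⟩ := ((hs y).1 hy).exists_nat_pow_eq
    refine ⟨k % Function.minimalPeriod f x, ?_, ?_⟩
    · rw [Finset.coe_range]
      exact Nat.mod_lt _ hpos
    · change f^[_] x = y
      rw [Function.iterate_mod_minimalPeriod_eq, Equiv.Perm.iterate_eq_pow, hk]

namespace VirtualLinkDiagram

open Rack

variable {μ : ℕ} (D : VirtualLinkDiagram μ) (o : D.MQ)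

/-! ### Longitudes act trivially -/

/-- Overpasses have zero turn, so the sum over undercrossings extends to all passages of the
component, as needed for travelling around it. -/
theorem coe_longitude (i : Fin μ) : (D.longitude i : D.RedAlexander) =
    ∑ p ∈ Finset.univ.filter fun p => D.comp p = i, D.turn p := by
  change D.sigma (D.toLam (D.longitudeChain i)) = _
  rw [longitudeChain_eq, map_sum, map_sum, underCrossings, Finset.sum_filter, Finset.sum_filter,
    Fintype.sum_prod_type]
  refine Finset.sum_congr rfl fun c _ => ?_
  rw [Fintype.sum_bool, kappa_b₁]
  have e : ∀ (x : D.Arc) (k : ℤ), D.sigma (D.toLam (Finsupp.single x k)) = k • D.arcClass x :=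
    fun x k => by
      rw [arcClass, ← map_zsmul, Finsupp.smul_single]
      simp [toLam]
  rw [map_sub, map_sub, e, e]
  simp [turn, smul_sub]

/-- One full trip around the component has the longitude as total turn and returns to the starting
arc. Without passages the longitude is an empty sum. -/
theorem perm_longitude_q (x : D.Arc) :
    D.perm o (D.longitude (D.kappa x)) (D.q x) = D.q x := by
  obtain ⟨p | ⟨i, hi⟩⟩ := x
  · change D.perm o (D.longitude (D.comp p)) (D.qAfter p) = D.qAfter p
    rw [coe_longitude, ← Equiv.Perm.sum_range_minimalPeriod D.next p _ (fun p' => ?_),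
      perm_sum_turn, Function.iterate_minimalPeriod]
    rw [Finset.mem_filter, ← D.comp_eq_iff, eq_comm (a := D.comp p)]
    simp
  · change D.perm o (D.longitude i) _ = _
    rw [coe_longitude, Finset.filter_false_of_mem fun p _ => hi p, Finset.sum_empty, perm_zero]
    rfl

theorem perm_eq_of_mem_longitudeSpan {a : D.Arc} {x : D.MQ} (hx : D.SameOrbit o (D.q a) x)
    {h : LinearMap.ker D.phiRed} (hh : h ∈ D.longitudeSpan (D.kappa a)) :
    D.perm o h x = x := by
  -- The action is commutative, so the stabilizer is constant along an orbit and x may be replaced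
  -- by q_a.
  obtain ⟨k, -, rfl⟩ := hx
  rw [perm_comm]
  congr 1
  let S : AddSubgroup D.RedAlexander :=
    { carrier := {h | D.perm o h (D.q a) = D.q a}
      zero_mem' := by rw [Set.mem_ofPred_eq, perm_zero]; rfl
      add_mem' := fun {h k} hh hk => by
        rw [Set.mem_ofPred_eq] at *
        rw [perm_add, Equiv.Perm.mul_apply, hk, hh]
      neg_mem' := fun {h} hh => by
        rw [Set.mem_ofPred_eq] at *
        rw [perm_neg, Equiv.Perm.inv_eq_iff_eq, hh] }
  obtain ⟨r, rfl⟩ := Submodule.mem_span_singleton.1 hh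
  have ht : Lam.t • (D.longitude (D.kappa a) : D.RedAlexander) = D.longitude (D.kappa a) := by
    have := D.smul_longitude (D.kappa a)
    rw [sub_smul, one_smul, sub_eq_zero] at this
    exact this.symm
  rw [Submodule.coe_smul, Lam.smul_eq_aug_smul ht]
  exact S.zsmul_mem (D.perm_longitude_q o a) _

/-! ### The annihilator of `1 - t` -/

/-- The hypothesis says that k is a cycle on a disjoint union of circles whose vertices are arcs and
whose edges are underpasses, so k is constant on each circle. The proof refines arcs to edges of the
diagram, where the passages of a component form an explicit cycle of `next`. -/
theorem eq_of_comp_eq_of_sum_eq_zero (k : D.Crossing → ℤ)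
    (hk : ∑ c, k c • (Finsupp.single (D.inArc c) (1 : ℤ) - Finsupp.single (D.outArc c) 1) = 0)
    {c c' : D.Crossing} (hc : D.comp (c, false) = D.comp (c', false)) : k c = k c' := by
  let v : D.Crossing × Bool → (D.Edge →₀ ℤ) := fun p =>
    Finsupp.single (.inl (D.next.symm p)) 1 - Finsupp.single (.inl p) 1
  let w : (D.Crossing →₀ ℤ) →ₗ[ℤ] (D.Edge →₀ ℤ) :=
    Finsupp.linearCombination ℤ fun c => v (c, true)
  let proj : (D.Edge →₀ ℤ) →ₗ[ℤ] (D.Arc →₀ ℤ) :=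
    Finsupp.linearCombination ℤ fun e => Finsupp.single (D.arc e) 1
  -- Inverts `proj` modulo the overpass relations: a chain of edges that vanishes on arcs is a
  -- combination of overpass differences.
  let sec : (D.Arc →₀ ℤ) →ₗ[ℤ] (D.Edge →₀ ℤ) ⧸ LinearMap.range w :=
    Finsupp.linearCombination ℤ (Quot.lift
      (fun e => (LinearMap.range w).mkQ (Finsupp.single e 1)) (by
        rintro _ _ ⟨c⟩
        rw [← sub_eq_zero, ← map_sub]
        refine (Submodule.Quotient.mk_eq_zero _).2 ⟨Finsupp.single c 1, ?_⟩
        simp [w, v]))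
  have hsec : sec ∘ₗ proj = (LinearMap.range w).mkQ := by
    apply Finsupp.lhom_ext'
    intro e
    ext
    simp only [proj, sec, LinearMap.comp_apply, Finsupp.lsingle_apply,
      Finsupp.linearCombination_single, one_smul]
    exact (Finsupp.linearCombination_single ℤ _ _).trans (one_smul ℤ _)
  have hz : proj (∑ c, k c • v (c, false)) = 0 := by
    rw [← hk, map_sum]
    refine Finset.sum_congr rfl fun c _ => ?_
    simp [proj, v, inArc, outArc]
  have hmem : (LinearMap.range w).mkQ (∑ c, k c • v (c, false)) = 0 := by
    rw [← hsec, LinearMap.comp_apply, hz, map_zero]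
  obtain ⟨l, hl⟩ := (Submodule.Quotient.mk_eq_zero _).1 hmem
  -- Extends k to overpasses by the coefficients -l, so that the relation holds among edges, not
  -- just among arcs.
  let K : D.Crossing × Bool → ℤ := fun p => if p.2 then - l p.1 else k p.1
  have hK : ∑ p, K p • v p = 0 := by
    have hl' : w l = ∑ c, l c • v (c, true) := by
      rw [Finsupp.linearCombination_apply, Finsupp.sum_fintype _ _ (by simp)]
    rw [Fintype.sum_prod_type]
    simp only [Fintype.sum_bool, Finset.sum_add_distrib, K, if_true, neg_smul,
      Finset.sum_neg_distrib, ← hl', hl]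
    simp
  -- The edge leaving p occurs only in `v p` and `v (D.next p)`, with opposite signs.
  have hnext : ∀ p, K (D.next p) = K p := fun p => by
    have := DFunLike.congr_fun hK (.inl p)
    simp only [v, Finsupp.finsetSum_apply, Finsupp.smul_apply, Finsupp.sub_apply,
      Finsupp.single_apply, Finsupp.zero_apply, Sum.inl.injEq, smul_eq_mul, mul_sub, mul_ite,
      mul_one, mul_zero, Finset.sum_sub_distrib, Equiv.symm_apply_eq, Finset.sum_ite_eq',
      Finset.mem_univ, if_true] at this
    exact sub_eq_zero.1 this
  obtain ⟨j, hj⟩ := ((D.comp_eq_iff _ _).1 hc).exists_nat_pow_eq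
  have hiter : ∀ j : ℕ, K ((D.next ^ j) (c, false)) = K (c, false) := fun j => by
    induction j with
    | zero => rfl
    | succ j ih => rw [pow_succ', Equiv.Perm.mul_apply, hnext, ih]
  have := hiter j
  rw [hj] at this
  exact this.symm

/-- Holds because ∑ w(c) b₁(c) = ∑ w(c) b₂(c). The chain-level form is what permits dividing by 1 -
t in the free module. -/
theorem smul_longitudeChain (i : Fin μ) : (1 - Lam.t) • D.toLam (D.longitudeChain i) =
    D.rho (∑ c ∈ D.underCrossings i, Finsupp.single c ((D.writhe c : ℤ) : Lam)) := by
  have h₂ := congrArg D.toLam (D.sum_writhe i)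
  rw [longitudeChain_eq]
  simp only [toLam, map_sum, map_sub, Finsupp.mapRange.addMonoidHom_apply,
    Finsupp.mapRange_single, Int.coe_castAddHom, rho, Finsupp.linearCombination_single] at h₂ ⊢
  simp only [smul_sub, smul_add, Finset.sum_sub_distrib, Finset.sum_add_distrib,
    Finsupp.smul_single, smul_eq_mul, mul_one, h₂, Finset.smul_sum]
  have e : ∀ c : D.Crossing, Finsupp.single (D.b₁ c) ((1 - Lam.t) * ((D.writhe c : ℤ) : Lam)) =
      Finsupp.single (D.b₁ c) ((D.writhe c : ℤ) : Lam) -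
        Finsupp.single (D.b₁ c) (((D.writhe c : ℤ) : Lam) * Lam.t) := fun c => by
    rw [← Finsupp.single_sub]
    congr 1
    ring
  simp only [e, Finset.sum_sub_distrib]
  simp only [mul_comm (1 - Lam.t)]
  abel

/-- The annihilator of `1 - t` in the reduced Alexander module is generated by the longitudes. -/
theorem exists_eq_sum_longitude {x : D.RedAlexander} (hx : (1 - Lam.t) • x = 0) :
    ∃ k : Fin μ → ℤ, x = ∑ i, k i • (D.longitude i : D.RedAlexander) := by
  obtain ⟨ξ, rfl⟩ := (LinearMap.range D.rho).mkQ_surjective x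
  rw [← map_smul] at hx
  obtain ⟨η, hη⟩ := (Submodule.Quotient.mk_eq_zero _).1 hx
  let augArc : (D.Arc →₀ Lam) →+ (D.Arc →₀ ℤ) :=
    Finsupp.mapRange.addMonoidHom Lam.aug.toAddMonoidHom
  -- Setting t = 1 in (1 - t)ξ = ϱ(η) kills the left side and the overpassing arcs; what remains is
  -- b₁ - b₂, which is the writhe times the arriving minus the leaving arc.
  have haug : ∑ c, ((D.writhe c : ℤ) * Lam.aug (η c)) •
      (Finsupp.single (D.inArc c) (1 : ℤ) - Finsupp.single (D.outArc c) 1) = 0 := by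
    have h₀ : augArc ((1 - Lam.t) • ξ) = 0 := by
      ext a
      simp [augArc, Lam.aug_t]
    rw [← hη, rho, Finsupp.linearCombination_apply, Finsupp.sum_fintype _ _ (by simp),
      map_sum] at h₀
    rw [← h₀]
    refine Finset.sum_congr rfl fun c _ => ?_
    have e : augArc (η c • (Finsupp.single (D.a c) (1 - Lam.t) + Finsupp.single (D.b₁ c) Lam.t
        - Finsupp.single (D.b₂ c) 1)) =
        Lam.aug (η c) • (Finsupp.single (D.b₁ c) 1 - Finsupp.single (D.b₂ c) 1) := by
      simp only [augArc, smul_sub, smul_add, Finsupp.smul_single, map_sub, map_add,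
        Finsupp.mapRange.addMonoidHom_apply, Finsupp.mapRange_single]
      simp [Lam.aug_t]
    rw [e]
    rcases Int.units_eq_one_or (D.writhe c) with hc | hc
    · simp [b₁, b₂, hc]
    · have : ((-1 : ℤˣ) = 1) = False := by simp
      simp only [b₁, b₂, hc, this, if_false]
      simp only [Units.val_neg, Units.val_one]
      module
  have hconst : ∃ k : Fin μ → ℤ, ∀ c,
      (D.writhe c : ℤ) * Lam.aug (η c) = k (D.comp (c, false)) := by
    classical
    -- The default 0 is for components that never pass under; their longitudes vanish.
    refine ⟨fun i => if h : ∃ c, D.comp (c, false) = i then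
      (D.writhe h.choose : ℤ) * Lam.aug (η h.choose) else 0, fun c => ?_⟩
    have h : ∃ c', D.comp (c', false) = D.comp (c, false) := ⟨c, rfl⟩
    refine Eq.trans ?_ (dif_pos h).symm
    exact D.eq_of_comp_eq_of_sum_eq_zero _ haug h.choose_spec.symm
  obtain ⟨k, hk⟩ := hconst
  choose s hs using fun c => Lam.dvd_sub_aug (η c)
  let η₁ : D.Crossing →₀ Lam := Finsupp.equivFunOnFinite.symm s
  have hη' : η = ∑ i, k i • (∑ c ∈ D.underCrossings i,
      Finsupp.single c ((D.writhe c : ℤ) : Lam)) + (1 - Lam.t) • η₁ := by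
    ext1 c
    have hc : (D.writhe c : ℤ) * (D.writhe c : ℤ) = 1 := by
      rw [← Units.val_mul, Int.units_mul_self, Units.val_one]
    have e : Lam.aug (η c) = k (D.comp (c, false)) * (D.writhe c : ℤ) := by
      rw [← hk, mul_right_comm, hc, one_mul]
    have e' : (∑ i, k i • (∑ c ∈ D.underCrossings i,
        Finsupp.single c ((D.writhe c : ℤ) : Lam))) c =
        (k (D.comp (c, false)) : Lam) * ((D.writhe c : ℤ) : Lam) := by
      simp only [Finsupp.finsetSum_apply, Finsupp.smul_apply, Finsupp.single_apply,
        Finset.sum_ite_eq', underCrossings, Finset.mem_filter, Finset.mem_univ, true_and,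
        kappa_b₁, smul_ite, smul_zero, Finset.sum_ite_eq, if_true, zsmul_eq_mul]
    rw [Finsupp.add_apply, e', ← Int.cast_mul, ← e]
    exact sub_eq_iff_eq_add'.1 (hs c)
  refine ⟨k, ?_⟩
  -- Both parts of η now map to multiples of 1 - t, and 1 - t can be cancelled coefficientwise in
  -- Λ^{A(D)}.
  have hξ : ξ = ∑ i, k i • D.toLam (D.longitudeChain i) + D.rho η₁ := by
    have h : (1 - Lam.t) • ξ =
        (1 - Lam.t) • (∑ i, k i • D.toLam (D.longitudeChain i) + D.rho η₁) := by
      rw [← hη, hη', map_add, map_smul, smul_add, map_sum, Finset.smul_sum]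
      congr 1
      refine Finset.sum_congr rfl fun i _ => ?_
      rw [map_zsmul, smul_comm, smul_longitudeChain]
    ext1 a
    have := DFunLike.congr_fun h a
    exact mul_left_cancel₀ Lam.one_sub_t_ne_zero this
  have h₁ : (LinearMap.range D.rho).mkQ (D.rho η₁) = 0 :=
    (Submodule.Quotient.mk_eq_zero _).2 ⟨_, rfl⟩
  conv_lhs => rw [hξ, map_add, h₁, add_zero, map_sum]
  refine Finset.sum_congr rfl fun i _ => ?_
  rw [map_zsmul]
  rfl

/-! ### The isomorphism -/

/-- The annihilator of 1 - t is spanned by all longitudes together. Equality of the X_i, which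
enters the argument only here, puts it inside each single X_i. -/
theorem mem_longitudeSpan (hX : ∀ i j, D.longitudeSpan i = D.longitudeSpan j) (i : Fin μ)
    {x : LinearMap.ker D.phiRed} (hx : (1 - Lam.t) • (x : D.RedAlexander) = 0) :
    x ∈ D.longitudeSpan i := by
  obtain ⟨k, hk⟩ := D.exists_eq_sum_longitude hx
  have e : x = ∑ j, k j • D.longitude j := Subtype.ext (by
    rw [hk, Submodule.coe_sum]
    rfl)
  rw [e]
  refine Submodule.sum_mem _ fun j _ => zsmul_mem ?_ _
  rw [hX i j]
  exact Submodule.mem_span_singleton_self _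

/-- Equal values force y = h · x with (1 - t)h = 0; such an h lies in the longitude span of the
component of x and fixes x. -/
theorem value_injective (hX : ∀ i j, D.longitudeSpan i = D.longitudeSpan j) :
    Function.Injective D.value := by
  intro x y hxy
  obtain ⟨h, hh, rfl⟩ := D.sameOrbit_of_value_eq x hxy
  obtain ⟨a, ha⟩ := D.exists_sameOrbit_q x x
  rw [D.value_perm x hh, left_eq_add] at hxy
  exact (D.perm_eq_of_mem_longitudeSpan x ha (h := ⟨h, hh⟩) (D.mem_longitudeSpan hX _ hxy)).symm

/-- The kernel of `φ_τ` is `(1 - t) ker φ`. -/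
theorem exists_one_sub_t_smul_eq {y : D.RedAlexander} (hy : D.phiTau y = 0) (a : D.Arc) :
    ∃ x, D.phiRed x = 0 ∧ y = (1 - Lam.t) • x := by
  let o := D.q a
  let W : Submodule Lam D.RedAlexander :=
    (LinearMap.ker D.phiRed).map (LinearMap.lsmul Lam D.RedAlexander (1 - Lam.t))
  have hW : ∀ x, D.phiRed x = 0 → W.mkQ ((1 - Lam.t) • x) = 0 := fun x hx =>
    (Submodule.Quotient.mk_eq_zero _).2 ⟨x, hx, rfl⟩
  -- Generators on one component share an orbit of ker φ, so their values differ by an element of (1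
  -- - t) ker φ.
  have hsame : ∀ b b' : D.Arc, D.kappa b = D.kappa b' →
      W.mkQ (D.arcClass b) = W.mkQ (D.arcClass b') := fun b b' h => by
    obtain ⟨h, hh, e⟩ := D.sameOrbit_q o h
    rw [← value_q, ← value_q, ← e, D.value_perm o hh, map_add, hW h hh, add_zero]
  have hfix : ∀ b b' : D.Arc, Lam.t • W.mkQ (D.arcClass b - D.arcClass b') =
      W.mkQ (D.arcClass b - D.arcClass b') := fun b b' => by
    rw [eq_comm, ← sub_eq_zero, ← map_smul, ← map_sub]
    have := hW (D.arcClass b - D.arcClass b') (by simp [phiRed_arcClass])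
    rwa [sub_smul, one_smul] at this
  choose rep hrep using D.exists_kappa_eq
  have hμ : 0 < μ := (D.kappa a).pos
  let b₀ := rep ⟨0, hμ⟩
  -- A map back from A_μ, sending 1 to an arc of the first component and e_j to the difference from
  -- it of an arc of K_j, which is fixed by t modulo W. It recovers the class modulo W from φ_τ, so
  -- the kernel of φ_τ lies in W.
  let sec : AMod μ →ₗ[Lam] D.RedAlexander ⧸ W :=
    LinearMap.coprod (LinearMap.toSpanSingleton Lam _ (W.mkQ (D.arcClass b₀)))
      (LinearMap.lsum Lam _ ℕ fun j => TrivInt.toFixed _ (hfix (rep j.val) b₀))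
  have hsec : sec ∘ₗ D.phiTau = W.mkQ := by
    apply Submodule.linearMap_qext
    apply Finsupp.lhom_ext'
    intro b
    ext
    change sec (D.phiTau (D.arcClass b)) = W.mkQ (D.arcClass b)
    rw [phiTau_arcClass]
    simp only [sec, arcVec, LinearMap.coprod_apply, LinearMap.toSpanSingleton_apply, one_smul,
      LinearMap.lsum_apply, LinearMap.sum_apply, LinearMap.comp_apply, LinearMap.proj_apply]
    by_cases hb : (D.kappa b).val = 0
    · rw [Finset.sum_eq_zero, add_zero]
      · exact hsame _ _ ((hrep _).trans (Fin.ext hb.symm))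
      · intro j _
        rw [if_neg fun h : D.kappa b = j.val => j.2 (h ▸ hb), map_zero]
    · rw [Finset.sum_eq_single ⟨D.kappa b, hb⟩]
      · rw [if_pos rfl, TrivInt.toFixed_one, map_sub, add_sub_cancel]
        exact hsame _ _ (hrep _)
      · intro j _ hj
        rw [if_neg fun h : D.kappa b = j.val => hj (Subtype.ext h.symm), map_zero]
      · simp
  have h0 : W.mkQ y = 0 := by
    rw [← hsec, LinearMap.comp_apply, hy, map_zero]
  obtain ⟨x, hx, h⟩ := (Submodule.Quotient.mk_eq_zero _).1 h0
  exact ⟨x, hx, h.symm⟩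

/-- The meridians of `K_i` form the coset `ς(a) + (1 - t) ker φ`, for any arc `a` of `K_i`. -/
theorem exists_meridian_eq (m : Fin μ → D.RedAlexander) (hm : ∀ i, m i ∈ D.meridians i)
    (a : D.Arc) : ∃ x, D.phiRed x = 0 ∧
    m (D.kappa a) = D.arcClass a + (1 - Lam.t) • x := by
  obtain ⟨b, hb, h⟩ := hm (D.kappa a)
  have hy : D.phiTau (m (D.kappa a) - D.arcClass a) = 0 := by
    rw [map_sub, h, phiTau_arcClass, phiTau_arcClass, D.arcVec_eq_iff.2 hb, sub_self]
  obtain ⟨x, hx, e⟩ := D.exists_one_sub_t_smul_eq hy a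
  exact ⟨x, hx, by rw [← e, add_sub_cancel]⟩

variable (m : Fin μ → D.RedAlexander) (hm : ∀ i, m i ∈ D.meridians i)

/-- The values of the elements of `MQ(L)` form `Q_A^red(L)`. -/
theorem range_value_eq :
    Set.range D.value = Set.range (D.medialData m hm).naturalMap := by
  ext z
  refine Iff.trans ?_ ((D.medialData m hm).mem_range_naturalMap z).symm
  constructor
  · rintro ⟨y, rfl⟩
    obtain ⟨a, h, hh, ey⟩ := D.exists_sameOrbit_q y y
    obtain ⟨x, hx, e⟩ := D.exists_meridian_eq m hm a
    refine ⟨D.kappa a, h - x, ?_, ?_⟩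
    · exact LinearMap.mem_ker.2 (by rw [map_sub, hh, hx, sub_zero])
    · change _ = m (D.kappa a) + _
      rw [e, ← ey, D.value_perm _ hh, value_q, smul_sub]
      abel
  · rintro ⟨i, x, hx, rfl⟩
    obtain ⟨a, rfl⟩ := D.exists_kappa_eq i
    obtain ⟨y, hy, e⟩ := D.exists_meridian_eq m hm a
    have hxy : D.phiRed (y + x) = 0 := by
      rw [map_add, hy, zero_add]
      exact hx
    -- The summand y compensates for the choice of meridian, m_i = ς(a) + (1 - t)y.
    refine ⟨D.perm (D.q a) (y + x) (D.q a), ?_⟩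
    rw [D.value_perm _ hxy, value_q]
    change _ = m (D.kappa a) + _
    rw [e, smul_add, add_assoc]

/-- Applying φ_τ to f(x) recovers the index i; within Q_i, a coincidence of images is a difference
killed by 1 - t, hence an element of X_i. -/
theorem naturalMap_injective (hX : ∀ i j, D.longitudeSpan i = D.longitudeSpan j) :
    Function.Injective (D.medialData m hm).naturalMap := by
  intro p p' h
  obtain ⟨i, x, rfl⟩ := (D.medialData m hm).exists_cls p
  obtain ⟨j, y, rfl⟩ := (D.medialData m hm).exists_cls p'
  rw [MedialData.naturalMap_cls, MedialData.naturalMap_cls] at h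
  change m i + (1 - Lam.t) • (x : D.RedAlexander) =
    m j + (1 - Lam.t) • (y : D.RedAlexander) at h
  obtain rfl : i = j := by
    obtain ⟨a, ha, ea⟩ := hm i
    obtain ⟨b, hb, eb⟩ := hm j
    have := congrArg D.phiTau h
    rw [map_add, map_add, D.phiTau_one_sub_t_smul x.2, D.phiTau_one_sub_t_smul y.2, add_zero,
      add_zero, ea, eb, phiTau_arcClass, phiTau_arcClass, arcVec_eq_iff] at this
    rw [← ha, ← hb, this]
  have hxy : x - y ∈ D.longitudeSpan i := by
    refine D.mem_longitudeSpan hX i ?_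
    change (1 - Lam.t) • ((x : D.RedAlexander) - y) = 0
    rw [smul_sub, sub_eq_zero]
    exact add_left_cancel h
  exact congrArg (Sigma.mk i) ((Submodule.Quotient.eq _).2 hxy)

end VirtualLinkDiagram

theorem mainTheorem5 {μ : ℕ} (D : VirtualLinkDiagram μ)
    (m : Fin μ → D.RedAlexander) (hm : ∀ i, m i ∈ D.meridians i)
    (hX : ∀ i j : Fin μ, D.longitudeSpan i = D.longitudeSpan j) :
    ∃ (g : D.MQ ≃ (D.medialData m hm).Carrier) (e : D.MQ ≃ D.QARed m hm),
      (∀ x y : D.MQ, g (x ◃ y) = g x ◃ g y) ∧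
      (∀ x y : D.MQ, e (x ◃ y) = e x ◃ e y) ∧
      (∀ x : D.MQ, (e x).val = (D.medialData m hm).naturalMap (g x)) ∧
      (∀ b : D.Arc, (e (D.q b)).val = D.arcClass b) := by
  have hf := D.naturalMap_injective m hm hX
  let e : D.MQ ≃ D.QARed m hm :=
    (Equiv.ofInjective D.value (D.value_injective hX)).trans
      (Equiv.setCongr (D.range_value_eq m hm))
  -- Defined by inverting f on its image, so that f ∘ g = e by construction; as f is an injective
  -- quandle map, g inherits the homomorphism property from `value`.
  let g : D.MQ ≃ (D.medialData m hm).Carrier := e.trans (Equiv.ofInjective _ hf).symm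
  have hg : ∀ x, (D.medialData m hm).naturalMap (g x) = D.value x := fun x =>
    Equiv.apply_ofInjective_symm hf (e x)
  have he : ∀ x y, e (x ◃ y) = e x ◃ e y := fun x y => Subtype.ext (D.value_act y x)
  refine ⟨g, e, fun x y => hf ?_, he, fun x => (hg x).symm, fun b => rfl⟩
  rw [ShelfHom.map_act, hg, hg, hg]
  exact D.value_act y x
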